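/- Let $T=\{1,\dots,n\}$ ($n\ge 1$) be a set of teams and $P$ a set of $m$ players. Each team $i$ has an additive valuation $v_i$ on sets of players that is binary, i.e. $v_i(p)\in\{0,1\}$ for every $p\in P$, and each player $p$ has a weak order (complete, transitive preference) $\succsim_p$ over the teams; the rank of team $i$ for $p$ is $1$ plus the number of teams that $p$ strictly prefers to $i$. An allocation is an ordered partition $A=(A_1,\dots,A_n)$ of $P$. It is EF1 if for all distinct teams $i,j$ there are $X\subseteq A_i$, $Y\subseteq A_j$ with $|X\cup Y|\le 1$ and $v_i(A_i\setminus X)\ge v_i(A_j\setminus Y)$. It is PO if there is no other allocation in which no team (by its valuation) and no player (by her preference) is worse off and at least one team or player is better off. The matching procedure, applied to a set of $k$ players and an order $t_0,\dots,t_{n-1}$ of the teams, has positions $q=0,1,\dots,k-1$, where position $q$ belongs to team $f(q)=t_{q\bmod n}$, and gives the pair $(q,p)$ the weight $w(q,p)=v_{f(q)}(p)$. It takes a perfect matching $\mu$ of positions and players whose weight at position $0$ is as large as possible, subject to this the weight at position $1$ is as large as possible, and so on; then, among all perfect matchings $\mu^*$ with $w(q,\mu^*_q)=w(q,\mu_q)$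 for all $q$, it takes one that minimizes the sum over all players of the rank of the team whose position the player is matched to; each player is allocated to that team. The algorithm: let $P^+=\{p:\max_i v_i(p)\ge 0\}$ and $P^-=P\setminus P^+$. Add to $P^+$ another $(n-1)|P^+|+n$ dummy players, and to $P^-$ another $(n-1)|P^-|+n$ dummy players, where dummy players have value $0$ for every team and are indifferent between all teams. Apply the matching procedure to the first set with the team order $1,\dots,n$ and to the second set with the order $n,\dots,1$; return the union of the two allocations with the dummy players removed. Then every allocation that the algorithm can return (whichever of the admissible matchings are chosen) is EF1 and PO. Moreover, the algorithm can be implemented in polynomial time: there is a program that, for every such instance, computes an allocation returned by the algorithm in a number of steps bounded by a polynomial in $n+m$. -/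

import Mathlib

namespace TwoSided

/-! ### Instances, allocations, fairness and efficiency -/

/-- An instance with team set `Fin n` and player set `P`: additive team valuations, given by their
values on single players, and a weak order of every player over the teams. -/
structure Market (n : ℕ) (P : Type*) where
  /-- `v i p` is the value of player `p` for team `i`. -/
  v : Fin n → P → ℝ
  /-- `pref p i j` says that player `p` weakly prefers team `i` to team `j`. -/
  pref : P → Fin n → Fin n → Prop
  pref_total : ∀ p i j, pref p i j ∨ pref p j i
  pref_trans : ∀ p i j k, pref p i j → pref p j k → pref p i k

namespace Market

variable {n : ℕ} {P : Type*}

/-- Player `p` strictly prefers team `i` to team `j`. -/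
def SPref (I : Market n P) (p : P) (i j : Fin n) : Prop :=
  I.pref p i j ∧ ¬ I.pref p j i

open Classical in
/-- The rank of team `i` for player `p`: one plus the number of strictly better teams. -/
noncomputable def rank (I : Market n P) (p : P) (i : Fin n) : ℕ :=
  1 + (Finset.univ.filter (fun j => I.SPref p j i)).card

/-- The additive valuation of team `i` on sets of players. -/
def value (I : Market n P) (i : Fin n) (S : Finset P) : ℝ :=
  ∑ p ∈ S, I.v i p

/-- Binary valuations. -/
def IsBinary (I : Market n P) : Prop :=
  ∀ i p, I.v i p = 0 ∨ I.v i p = 1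

end Market

/-- An allocation: an ordered partition of the players into `n` (possibly empty) parts, recorded by
the map that sends a player to her team. -/
abbrev Alloc (n : ℕ) (P : Type*) := P → Fin n

/-- The set of players of team `i`. -/
def Alloc.part {n : ℕ} {P : Type*} [Fintype P] (A : Alloc n P) (i : Fin n) : Finset P :=
  Finset.univ.filter (fun p => A p = i)

namespace Market

variable {n : ℕ} {P : Type*} [Fintype P]

/-- Envy-freeness up to one player. -/
def EF1 [DecidableEq P] (I : Market n P) (A : Alloc n P) : Prop :=
  ∀ i j : Fin n, i ≠ j → ∃ X Y : Finset P, X ⊆ A.part i ∧ Y ⊆ A.part j ∧ (X ∪ Y).card ≤ 1 ∧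
    I.value i (A.part j \ Y) ≤ I.value i (A.part i \ X)

/-- `A'` is a Pareto improvement of `A`: no team and no player is worse off, and at least one team
or one player is better off. -/
def ParetoDominates (I : Market n P) (A' A : Alloc n P) : Prop :=
  (∀ i, I.value i (A.part i) ≤ I.value i (A'.part i)) ∧
  (∀ p, I.pref p (A' p) (A p)) ∧
  ((∃ i, I.value i (A.part i) < I.value i (A'.part i)) ∨ ∃ p, I.SPref p (A' p) (A p))

/-- Pareto optimality, with respect to teams and players together. -/
def PO (I : Market n P) (A : Alloc n P) : Prop :=
  ∀ A' : Alloc n P, ¬ I.ParetoDominates A' A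

/-! ### The allocation algorithm -/

/-- The positions `Q = {0, …, m - 1}`, where `m` is the number of players. -/
abbrev Slot (P : Type*) [Fintype P] := Fin (Fintype.card P)

/-- The team that position `q` belongs to, when the teams `σ 0, σ 1, …, σ (n - 1)` take turns. -/
def slotTeam [NeZero n] (σ : Equiv.Perm (Fin n)) (q : Slot P) : Fin n :=
  σ (Fin.ofNat n q)

/-- The weight of the edge `(q, p)` of the complete bipartite graph between `Q` and `P`. -/
def weight [NeZero n] (I : Market n P) (σ : Equiv.Perm (Fin n)) (q : Slot P) (p : P) : ℝ :=
  I.v (slotTeam σ q) p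

/-- The perfect matching `μ` makes the weight at position `0` as large as possible, subject to this
the weight at position `1` as large as possible, and so on. -/
def IsLexMax [NeZero n] (I : Market n P) (σ : Equiv.Perm (Fin n)) (μ : Slot P ≃ P) : Prop :=
  ∀ (q : Slot P) (ν : Slot P ≃ P),
    (∀ r, r < q → I.weight σ r (ν r) = I.weight σ r (μ r)) →
      I.weight σ q (ν q) ≤ I.weight σ q (μ q)

/-- `ν` is a perfect matching of the graph `G*` that keeps the edges `(q, p)` which have the same
weight as the edge of `μ` at `q`. -/
def InTight [NeZero n] (I : Market n P) (σ : Equiv.Perm (Fin n)) (μ ν : Slot P ≃ P) : Prop :=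
  ∀ q, I.weight σ q (ν q) = I.weight σ q (μ q)

/-- The sum over all players of the rank of the team to which the matching `ν` sends them. -/
noncomputable def rankSum [NeZero n] (I : Market n P) (σ : Equiv.Perm (Fin n)) (ν : Slot P ≃ P) :
    ℕ :=
  ∑ p, I.rank p (slotTeam σ (ν.symm p))

/-- `A` is a possible result of the matching-based round-robin procedure with team order `σ` (the
matchings `μ` and `μ'` may be any ones with the required properties). -/
def RoundRobinOutput [NeZero n] (I : Market n P) (σ : Equiv.Perm (Fin n)) (A : Alloc n P) : Prop :=
  ∃ μ μ' : Slot P ≃ P, I.IsLexMax σ μ ∧ I.InTight σ μ μ' ∧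
    (∀ ν, I.InTight σ μ ν → I.rankSum σ μ' ≤ I.rankSum σ ν) ∧
    ∀ p, A p = slotTeam σ (μ'.symm p)

/-- The instance with the players of `S` and `d` dummy players, who have value `0` for every team
and are indifferent between all teams. -/
def withDummies (I : Market n P) (S : Finset P) (d : ℕ) : Market n ({p // p ∈ S} ⊕ Fin d) where
  v i := Sum.elim (fun p => I.v i p) (fun _ => 0)
  pref := Sum.elim (fun p => I.pref p) (fun _ _ _ => True)
  pref_total := by
    rintro (p | p) i j
    · exact I.pref_total p i j
    · exact Or.inl trivial
  pref_trans := by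
    rintro (p | p) i j k
    · exact I.pref_trans p i j k
    · exact fun _ _ => trivial

/-- The number of dummy players that are added to a set of `k` players. -/
def numDummies (n k : ℕ) : ℕ := (n - 1) * k + n

open Classical in
/-- The players whose largest value for a team is nonnegative. -/
noncomputable def plusPlayers (I : Market n P) : Finset P :=
  Finset.univ.filter (fun p => ∃ i, 0 ≤ I.v i p)

open Classical in
/-- The players whose largest value for a team is negative. -/
noncomputable def minusPlayers (I : Market n P) : Finset P :=
  Finset.univ.filter (fun p => ∀ i, I.v i p < 0)

/-- `A` is a possible result of the two-phase algorithm: the procedure is run on the players of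
`P⁺` with dummy players and teams in forward order, and on the players of `P⁻` with dummy players
and teams in backward order; `A` is the union of the two results without the dummy players. -/
def AlgorithmOutput [NeZero n] (I : Market n P) (A : Alloc n P) : Prop :=
  ∃ (Aplus : Alloc n ({p // p ∈ I.plusPlayers} ⊕ Fin (numDummies n I.plusPlayers.card)))
    (Aminus : Alloc n ({p // p ∈ I.minusPlayers} ⊕ Fin (numDummies n I.minusPlayers.card))),
    (I.withDummies I.plusPlayers (numDummies n I.plusPlayers.card)).RoundRobinOutput
      (Equiv.refl (Fin n)) Aplus ∧
    (I.withDummies I.minusPlayers (numDummies n I.minusPlayers.card)).RoundRobinOutput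
      Fin.revPerm Aminus ∧
    (∀ p : {p // p ∈ I.plusPlayers}, A p = Aplus (Sum.inl p)) ∧
    (∀ p : {p // p ∈ I.minusPlayers}, A p = Aminus (Sum.inl p))

end Market

/-! ### A machine model with a step count

Programs for a random access machine whose registers and array cells hold natural numbers. The only
arithmetic operations are addition and truncated subtraction, so that unit costs are polynomially
equivalent to Turing machine time. -/

/-- Expressions. The name `a` of an array is fixed in the program; its index is computed. -/
inductive RExpr where
  | const (k : ℕ)
  | reg (x : ℕ)
  | load (a : ℕ) (idx : RExpr)
  | add (e₁ e₂ : RExpr)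
  | sub (e₁ e₂ : RExpr)
  | lt (e₁ e₂ : RExpr)
  | eq (e₁ e₂ : RExpr)

/-- Programs. A test is passed if the value of its expression is not `0`. -/
inductive Prog where
  | skip
  | assign (x : ℕ) (e : RExpr)
  | store (a : ℕ) (idx e : RExpr)
  | seq (c₁ c₂ : Prog)
  | ite (e : RExpr) (c₁ c₂ : Prog)
  | loop (e : RExpr) (c : Prog)

/-- Memory contents: registers `reg x` and array cells `arr a k`. -/
@[ext] structure Store where
  reg : ℕ → ℕ
  arr : ℕ → ℕ → ℕ

/-- The value of an expression. -/
def RExpr.eval (s : Store) : RExpr → ℕ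
  | .const k => k
  | .reg x => s.reg x
  | .load a idx => s.arr a (idx.eval s)
  | .add e₁ e₂ => e₁.eval s + e₂.eval s
  | .sub e₁ e₂ => e₁.eval s - e₂.eval s
  | .lt e₁ e₂ => if e₁.eval s < e₂.eval s then 1 else 0
  | .eq e₁ e₂ => if e₁.eval s = e₂.eval s then 1 else 0

/-- The number of steps of evaluating an expression: one for each node. -/
def RExpr.cost : RExpr → ℕ
  | .const _ => 1
  | .reg _ => 1
  | .load _ idx => idx.cost + 1
  | .add e₁ e₂ => e₁.cost + e₂.cost + 1
  | .sub e₁ e₂ => e₁.cost + e₂.cost + 1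
  | .lt e₁ e₂ => e₁.cost + e₂.cost + 1
  | .eq e₁ e₂ => e₁.cost + e₂.cost + 1

/-- The memory after writing `k` into register `x`. -/
def Store.setReg (s : Store) (x k : ℕ) : Store :=
  { s with reg := Function.update s.reg x k }

/-- The memory after writing `k` into cell `idx` of array `a`. -/
def Store.setArr (s : Store) (a idx k : ℕ) : Store :=
  { s with arr := Function.update s.arr a (Function.update (s.arr a) idx k) }

/-- `Exec c s t s'`: the program `c`, started in memory `s`, halts after exactly `t` steps in
memory `s'`. -/
inductive Exec : Prog → Store → ℕ → Store → Prop where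
  | skip (s : Store) : Exec .skip s 1 s
  | assign (x : ℕ) (e : RExpr) (s : Store) :
      Exec (.assign x e) s (e.cost + 1) (s.setReg x (e.eval s))
  | store (a : ℕ) (idx e : RExpr) (s : Store) :
      Exec (.store a idx e) s (idx.cost + e.cost + 1) (s.setArr a (idx.eval s) (e.eval s))
  | seq {c₁ c₂ : Prog} {s s' s'' : Store} {t₁ t₂ : ℕ} :
      Exec c₁ s t₁ s' → Exec c₂ s' t₂ s'' → Exec (.seq c₁ c₂) s (t₁ + t₂) s''
  | ite_true {e : RExpr} {c₁ c₂ : Prog} {s s' : Store} {t : ℕ} :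
      e.eval s ≠ 0 → Exec c₁ s t s' → Exec (.ite e c₁ c₂) s (e.cost + 1 + t) s'
  | ite_false {e : RExpr} {c₁ c₂ : Prog} {s s' : Store} {t : ℕ} :
      e.eval s = 0 → Exec c₂ s t s' → Exec (.ite e c₁ c₂) s (e.cost + 1 + t) s'
  | loop_done {e : RExpr} {c : Prog} {s : Store} :
      e.eval s = 0 → Exec (.loop e c) s (e.cost + 1) s
  | loop_step {e : RExpr} {c : Prog} {s s' s'' : Store} {t₁ t₂ : ℕ} :
      e.eval s ≠ 0 → Exec c s t₁ s' → Exec (.loop e c) s' t₂ s'' →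
        Exec (.loop e c) s (e.cost + 1 + t₁ + t₂) s''

open Classical in
/-- The initial memory for an instance with binary valuations: the numbers of teams and of players
in registers `0` and `1`, the table of valuations in array `0` (player by player), the tables of the
players' preferences in array `1`, and zeros everywhere else. -/
noncomputable def Market.input {n m : ℕ} (I : Market n (Fin m)) : Store where
  reg x := if x = 0 then n else if x = 1 then m else 0
  arr a k :=
    if a = 0 ∧ ∃ (p : Fin m) (i : Fin n), k = (p : ℕ) * n + i ∧ I.v i p = 1 then 1
    else if a = 1 ∧ ∃ (p : Fin m) (i j : Fin n), k = ((p : ℕ) * n + i) * n + j ∧ I.pref p i j then 1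
    else 0

/-- The memory holds the allocation `A` in array `2`. -/
def Store.Holds {n m : ℕ} (s : Store) (A : Alloc n (Fin m)) : Prop :=
  ∀ p : Fin m, s.arr 2 p = A p

end TwoSided

namespace TwoSided

namespace Market

variable {n : ℕ} {P Q : Type*}

/-! ### Ranks -/

/-! With binary valuations every player lies in P⁺, so the second phase handles only dummies and the
output is a single run of the matching procedure on n·m + n positions, where m is the number of true
players.

EF1. Swapping the players of positions q < q' leaves all earlier positions alone, so lexicographic
maximality makes the owner of q value its player at least as much as any later one
(`IsLexMax.v_le_weight`). Each position of team j after the first round is preceded by the position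
of team i one round earlier. Hence i does not envy j once j's first-round player is removed
(`IsPadding.eF1`).

PO. Let A' be a Pareto improvement. Every team owns at least m positions, and in A' it has at least
as many players of value one as it has positions of weight one in μ. So A' is realized by a matching
ν that puts valuable players on those positions. Then ν is nowhere lighter than μ, and lexicographic
maximality makes all weights equal (`IsLexMax.inTight_of_le`). Thus ν competes with μ in the second
stage: no team gains, and a player who gains would lower the rank sum (`IsPadding.pO`).

Polynomial time. Both stages merge into one assignment problem for the true players, with cost rank
− M·2^(K−1−q)·value for position q out of K. The powers of two encode the lexicographic order, and M
exceeds every rank sum (`IsPadding.optimal_of_cost`). An offset makes the costs natural numbers. The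
Hungarian method solves the problem: rows are inserted one at a time, an alternating tree of tight
edges grows by one column per dual update, and the path to an unused column is flipped. `Dual`,
`Tree` and `Flip` are the invariants; weak duality (`Dual.sum_le`) gives optimality.

The program is verified with a calculus of total correctness with step bounds (`Run`). Multiples,
residues and powers are tabulated by additions, because the machine has no multiplication. -/

theorem rank_le_of_pref (I : Market n P) {p : P} {i j : Fin n} (h : I.pref p i j) :
    I.rank p i ≤ I.rank p j := by
  classical
  unfold rank
  gcongr 1 + ?_
  refine Finset.card_le_card fun k hk => ?_
  have hk := (Finset.mem_filter.1 hk).2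
  exact Finset.mem_filter.2 ⟨Finset.mem_univ _, I.pref_trans p k i j hk.1 h,
    fun h' => hk.2 (I.pref_trans p i j k h h')⟩

theorem rank_lt_of_sPref (I : Market n P) {p : P} {i j : Fin n} (h : I.SPref p i j) :
    I.rank p i < I.rank p j := by
  classical
  unfold rank
  refine Nat.add_lt_add_left (Finset.card_lt_card ?_) 1
  refine Finset.ssubset_iff_subset_ne.2 ⟨fun k hk => ?_, fun he => ?_⟩
  · have hk := (Finset.mem_filter.1 hk).2
    exact Finset.mem_filter.2 ⟨Finset.mem_univ _, I.pref_trans p k i j hk.1 h.1,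
      fun h' => hk.2 (I.pref_trans p i j k h.1 h')⟩
  · have hi : i ∈ Finset.univ.filter (fun k => I.SPref p k i) :=
      he ▸ Finset.mem_filter.2 ⟨Finset.mem_univ _, h⟩
    have hi := (Finset.mem_filter.1 hi).2
    exact hi.2 hi.1

/-! ### Markets padded with dummy players -/

/-- `J` is the market `I`, whose players are embedded by `ι`, with dummy players added. -/
structure IsPadding (I : Market n P) (J : Market n Q) (ι : P → Q) : Prop where
  inj : Function.Injective ι
  v_apply : ∀ i p, J.v i (ι p) = I.v i p
  v_dummy : ∀ i x, x ∉ Set.range ι → J.v i x = 0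
  pref_apply : ∀ p i j, J.pref (ι p) i j ↔ I.pref p i j
  pref_dummy : ∀ x, x ∉ Set.range ι → ∀ i j, J.pref x i j

theorem isPadding_withDummies (I : Market n P) [Fintype P] (S : Finset P) (hS : ∀ p, p ∈ S)
    (d : ℕ) : I.IsPadding (I.withDummies S d) (fun p => Sum.inl ⟨p, hS p⟩) where
  inj p p' h := by simpa using h
  v_apply i p := rfl
  v_dummy i x hx := by
    rcases x with x | x
    · exact absurd ⟨x.1, rfl⟩ hx
    · rfl
  pref_apply p i j := Iff.rfl
  pref_dummy x hx i j := by
    rcases x with x | x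
    · exact absurd ⟨x.1, rfl⟩ hx
    · trivial

namespace IsPadding

variable {I : Market n P} {J : Market n Q} {ι : P → Q}

theorem isBinary (h : I.IsPadding J ι) (hb : I.IsBinary) : J.IsBinary := by
  intro i x
  by_cases hx : x ∈ Set.range ι
  · obtain ⟨p, rfl⟩ := hx
    rw [h.v_apply]
    exact hb i p
  · exact Or.inl (h.v_dummy i x hx)

theorem sPref_apply (h : I.IsPadding J ι) (p : P) (i j : Fin n) :
    J.SPref (ι p) i j ↔ I.SPref p i j := by
  simp [SPref, h.pref_apply]

theorem rank_apply (h : I.IsPadding J ι) (p : P) (i : Fin n) : J.rank (ι p) i = I.rank p i := by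
  unfold rank
  congr 2
  ext j
  simp only [Finset.mem_filter, h.sPref_apply]

theorem rank_dummy (h : I.IsPadding J ι) {x : Q} (hx : x ∉ Set.range ι) (i : Fin n) :
    J.rank x i = 1 := by
  simp [rank, SPref, h.pref_dummy x hx]

/-- Dummy players do not contribute to sums of values over positions. -/
theorem sum_slots [Fintype P] [Fintype Q] (h : I.IsPadding J ι) (ν : Slot Q ≃ Q)
    (T : Slot Q → Prop) [DecidablePred T] {M : Type*} [AddCommMonoid M] (g : Slot Q → Q → M)
    (hg : ∀ q x, x ∉ Set.range ι → g q x = 0) :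
    ∑ p with T (ν.symm (ι p)), g (ν.symm (ι p)) (ι p) = ∑ q with T q, g q (ν q) := by
  classical
  rw [← Finset.sum_subset (s₁ := (Finset.univ.filter (fun p => T (ν.symm (ι p)))).image
    (fun p => ν.symm (ι p)))]
  · rw [Finset.sum_image]
    · simp
    · intro p _ p' _ hp
      exact h.inj (ν.symm.injective hp)
  · intro q hq
    simp only [Finset.mem_image, Finset.mem_filter, Finset.mem_univ, true_and] at hq ⊢
    obtain ⟨p, hp, rfl⟩ := hq
    exact hp
  · intro q hq hq'
    apply hg
    rintro ⟨p, hp⟩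
    apply hq'
    simp only [Finset.mem_image, Finset.mem_filter, Finset.mem_univ, true_and] at hq ⊢
    exact ⟨p, by simpa [hp] using hq, by simp [hp]⟩

/-- Dummies are worth nothing, so a team's value can be read off its positions. This turns questions
about teams into questions about weights. -/
theorem value_part [Fintype P] [Fintype Q] [NeZero n] (h : I.IsPadding J ι)
    (σ : Equiv.Perm (Fin n)) (ν : Slot Q ≃ Q) (A : Alloc n P)
    (hA : ∀ p, A p = slotTeam σ (ν.symm (ι p))) (i : Fin n) :
    I.value i (A.part i) = ∑ q with slotTeam σ q = i, J.weight σ q (ν q) := by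
  have := h.sum_slots ν (fun q => slotTeam σ q = i) (fun _ x => J.v i x)
    (fun _ x hx => h.v_dummy i x hx)
  simp only [h.v_apply] at this
  unfold value Alloc.part
  simp only [hA]
  rw [this]
  refine Finset.sum_congr rfl fun q hq => ?_
  simp only [Finset.mem_filter, Finset.mem_univ, true_and] at hq
  rw [weight, hq]

end IsPadding

/-! ### Lexicographically maximal matchings -/

section LexMax

variable [Fintype P] [NeZero n] {I : Market n P} {σ : Equiv.Perm (Fin n)} {μ ν : Slot P ≃ P}

/-- Exchanging the players of the two positions gives a competitor that agrees with `μ` before `q`.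
-/
theorem IsLexMax.v_le_weight (hμ : I.IsLexMax σ μ) {q q' : Slot P} (hq : q < q') :
    I.v (slotTeam σ q) (μ q') ≤ I.weight σ q (μ q) := by
  have := hμ q ((Equiv.swap q q').trans μ) (fun r hr => by
    simp [Equiv.swap_apply_of_ne_of_ne hr.ne (hr.trans hq).ne])
  simpa [weight] using this

/-- Lexicographic maximality depends only on the sequence of weights, so it passes to the matching
chosen in the second stage. -/
theorem IsLexMax.of_inTight (hμ : I.IsLexMax σ μ) (hν : I.InTight σ μ ν) : I.IsLexMax σ ν := by
  intro q τ hτ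
  rw [hν q]
  exact hμ q τ fun r hr => (hτ r hr).trans (hν r)

/-- By induction along the positions: once all earlier weights agree, maximality at `q` supplies the
missing inequality. -/
theorem IsLexMax.inTight_of_le (hμ : I.IsLexMax σ μ)
    (h : ∀ q, I.weight σ q (μ q) ≤ I.weight σ q (ν q)) : I.InTight σ μ ν := by
  intro q
  induction q using WellFoundedLT.induction with
  | ind q ih => exact le_antisymm (hμ q ν ih) (h q)

end LexMax

/-! ### Fairness -/

/-- Round k of team `j` is charged to round k − 1 of team `i`, which comes earlier whatever the
order of `i` and `j`. Only `Y` is ever needed. -/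
theorem IsPadding.eF1 [Fintype P] [Fintype Q] [DecidableEq P] [NeZero n] {I : Market n P}
    {J : Market n Q} {ι : P → Q} (h : I.IsPadding J ι) (hb : I.IsBinary) {ν : Slot Q ≃ Q}
    (hν : J.IsLexMax (Equiv.refl _) ν) (A : Alloc n P)
    (hA : ∀ p, A p = slotTeam (Equiv.refl _) (ν.symm (ι p))) : I.EF1 A := by
  intro i j hij
  have hn : 0 < n := NeZero.pos n
  -- The true player, if any, whom team `j` gets in the first round.
  set Y : Finset P := (A.part j).filter (fun p => (ν.symm (ι p) : ℕ) < n) with hY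
  have hteam : ∀ (q : Slot Q) (k : Fin n), slotTeam (Equiv.refl _) q = k ↔ (q : ℕ) % n = k := by
    intro q k
    simp [slotTeam, Fin.ext_iff]
  refine ⟨∅, Y, by simp, Finset.filter_subset _ _, ?_, ?_⟩
  · rw [Finset.empty_union, Finset.card_le_one]
    intro p hp p' hp'
    simp only [hY, Alloc.part, Finset.mem_filter, Finset.mem_univ, true_and, hA, hteam] at hp hp'
    rw [Nat.mod_eq_of_lt hp.2] at hp
    rw [Nat.mod_eq_of_lt hp'.2] at hp'
    exact h.inj (ν.symm.injective (Fin.ext (hp.1.trans hp'.1.symm)))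
  · rw [Finset.sdiff_empty, h.value_part _ ν A hA]
    have key := h.sum_slots ν (fun q => (q : ℕ) % n = j ∧ n ≤ (q : ℕ)) (fun _ x => J.v i x)
      (fun _ x hx => h.v_dummy i x hx)
    have e1 : A.part j \ Y = Finset.univ.filter
        (fun p => ((ν.symm (ι p) : ℕ) % n = j ∧ n ≤ (ν.symm (ι p) : ℕ))) := by
      ext p
      simp only [hY, Alloc.part, Finset.mem_sdiff, Finset.mem_filter, Finset.mem_univ, true_and,
        hA, hteam, ← not_lt]
      tauto
    simp only [h.v_apply] at key
    rw [value, e1, key]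
    simp only [hteam]
    have hlt : ∀ q : Slot Q, (q : ℕ) % n = j ∧ n ≤ (q : ℕ) →
        ((q : ℕ) / n - 1) * n + i < (q : ℕ) := by
      intro q hq
      have h1 : 1 ≤ (q : ℕ) / n := (Nat.one_le_div_iff hn).2 hq.2
      have h2 := Nat.div_add_mod' (q : ℕ) n
      have h3 : ((q : ℕ) / n - 1) * n + n = (q : ℕ) / n * n := by
        rw [Nat.sub_mul, one_mul, Nat.sub_add_cancel]
        exact Nat.le_mul_of_pos_left n h1
      have := i.2
      omega
    classical
    -- The position of team `i` one round before `q`; the value off the later rounds of `j` is a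
    -- dummy.
    let s : Slot Q → Slot Q := fun q => if hq : (q : ℕ) % n = j ∧ n ≤ (q : ℕ) then
      ⟨((q : ℕ) / n - 1) * n + i, (hlt q hq).trans q.2⟩ else q
    have hs : ∀ q : Slot Q, (q : ℕ) % n = j ∧ n ≤ (q : ℕ) →
        (s q : ℕ) = ((q : ℕ) / n - 1) * n + i := by
      intro q hq
      simp only [s]
      rw [dif_pos hq]
    have hsm : ∀ q : Slot Q, (q : ℕ) % n = j ∧ n ≤ (q : ℕ) → (s q : ℕ) % n = i := by
      intro q hq
      rw [hs q hq, Nat.mul_add_mod_self_right, Nat.mod_eq_of_lt i.2]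
    have hsd : ∀ q : Slot Q, (q : ℕ) % n = j ∧ n ≤ (q : ℕ) → (s q : ℕ) / n = (q : ℕ) / n - 1 := by
      intro q hq
      rw [hs q hq, add_comm, Nat.add_mul_div_right _ _ hn, Nat.div_eq_of_lt i.2, zero_add]
    have hJ := h.isBinary hb
    let T : Slot Q → Prop := fun q => (q : ℕ) % n = j ∧ n ≤ (q : ℕ)
    calc ∑ q with T q, J.v i (ν q)
        ≤ ∑ q with T q, J.weight (Equiv.refl _) (s q) (ν (s q)) := by
          refine Finset.sum_le_sum fun q hq => ?_
          replace hq := (Finset.mem_filter.1 hq).2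
          have := hν.v_le_weight (q := s q) (q' := q) (Fin.lt_def.2 (by
            rw [hs q hq]; exact hlt q hq))
          rwa [(hteam (s q) i).2 (hsm q hq)] at this
      _ = ∑ q ∈ (Finset.univ.filter T).image s,
            J.weight (Equiv.refl _) q (ν q) := by
          rw [Finset.sum_image]
          intro q hq q' hq' he
          replace hq := (Finset.mem_filter.1 hq).2
          replace hq' := (Finset.mem_filter.1 hq').2
          have h1 := hsd q hq
          have h2 := hsd q' hq'
          rw [he, h2] at h1
          have h3 : 1 ≤ (q : ℕ) / n := (Nat.one_le_div_iff hn).2 hq.2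
          have h4 : 1 ≤ (q' : ℕ) / n := (Nat.one_le_div_iff hn).2 hq'.2
          have h5 : (q : ℕ) / n = (q' : ℕ) / n := by omega
          ext
          rw [← Nat.div_add_mod' (q : ℕ) n, ← Nat.div_add_mod' (q' : ℕ) n, h5, hq.1, hq'.1]
      _ ≤ _ := by
          -- The positions of `i` that are not hit by `s` have nonnegative weight.
          refine Finset.sum_le_sum_of_subset_of_nonneg ?_ ?_
          · intro q hq
            obtain ⟨q', hq', rfl⟩ := Finset.mem_image.1 hq
            exact Finset.mem_filter.2 ⟨Finset.mem_univ _, hsm q' (Finset.mem_filter.1 hq').2⟩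
          · intro q _ _
            rcases hJ (slotTeam (Equiv.refl _) q) (ν q) with h0 | h0 <;> simp [weight, h0]

/-! ### Efficiency -/

/-- An injection from a subset of a finite set `s` into a set that is at least as large as `s`
extends to an injection of `s`. -/
theorem exists_injOn_extend {α β : Type*} [DecidableEq α] [DecidableEq β] {s₀ s : Finset α}
    {t : Finset β} {f : α → β} (hs : s₀ ⊆ s) (hft : ∀ a ∈ s₀, f a ∈ t) (hf : Set.InjOn f s₀)
    (hc : s.card ≤ t.card) :
    ∃ g : α → β, Set.InjOn g s ∧ (∀ a ∈ s, g a ∈ t) ∧ ∀ a ∈ s₀, g a = f a := by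
  classical
  obtain ⟨t', h1, h2, h3⟩ := Finset.exists_subsuperset_card_eq (s := s₀.image f) (t := t)
    (by simpa [Finset.image_subset_iff] using hft)
    (Finset.card_image_le.trans (Finset.card_le_card hs)) hc
  obtain ⟨g, hg⟩ := Finset.exists_equiv_extend_of_card_eq (α := s) (t := t')
    (s := Finset.univ.filter (fun a : s => (a : α) ∈ s₀)) (f := fun a : s => f a)
    (by simp [h3]) (by
      intro b hb
      simp only [Finset.mem_image, Finset.mem_filter, Finset.mem_univ, true_and] at hb
      obtain ⟨a, ha, rfl⟩ := hb
      exact h1 (Finset.mem_image_of_mem f ha)) (by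
      intro a ha b hb hab
      exact Subtype.ext (hf (Finset.mem_filter.1 ha).2 (Finset.mem_filter.1 hb).2 hab))
  by_cases hne : s = ∅
  · subst hne
    exact ⟨f, by simp, by simp, by simp⟩
  refine ⟨fun a => if ha : a ∈ s then (g ⟨a, ha⟩ : β) else f a, ?_, ?_, ?_⟩
  · intro a ha b hb hab
    have ha' : a ∈ s := ha
    have hb' : b ∈ s := hb
    simp only [dif_pos ha', dif_pos hb'] at hab
    exact congrArg Subtype.val (g.injective (Subtype.ext hab))
  · intro a ha
    simp only [dif_pos ha]
    exact h2 (g ⟨a, ha⟩).2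
  · intro a ha
    simp only [dif_pos (hs ha)]
    exact hg ⟨a, hs ha⟩ (by simpa using ha)

/-- There are as many positions as players, so the dummies can fill whatever the true players leave
open. -/
theorem exists_slot_equiv [Fintype P] [Fintype Q] {ι : P → Q} (hι : Function.Injective ι)
    {f : P → Slot Q} (hf : Function.Injective f) :
    ∃ ν : Slot Q ≃ Q, ∀ p, ν.symm (ι p) = f p := by
  classical
  -- `Function.invFun` below needs a nonempty domain.
  rcases isEmpty_or_nonempty P with hP | hP
  · exact ⟨(Fintype.equivFin Q).symm, fun p => hP.elim p⟩
  obtain ⟨g, hg⟩ := Finset.exists_equiv_extend_of_card_eq (α := Q) (t := (Finset.univ : Finset (Slot Q)))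
    (s := Finset.univ.image ι) (f := fun x => f (Function.invFun ι x)) (by simp) (by simp) (by
      intro a ha b hb hab
      simp only [Finset.coe_image, Finset.coe_univ, Set.image_univ, Set.mem_range] at ha hb
      obtain ⟨p, rfl⟩ := ha
      obtain ⟨p', rfl⟩ := hb
      have := hf hab
      rw [Function.leftInverse_invFun hι, Function.leftInverse_invFun hι] at this
      rw [this])
  refine ⟨(g.trans (Equiv.subtypeUnivEquiv (fun _ => Finset.mem_univ _))).symm, fun p => ?_⟩
  have := hg (ι p) (by simp)
  rw [Function.leftInverse_invFun hι] at this
  simpa using this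

/-- This is what the dummies are for: even an allocation that sends all players to one team fits
into the positions. Those used here are `r * n + σ⁻¹ i`. -/
theorem card_le_card_slots [Fintype P] [Fintype Q] [NeZero n]
    (hc : n * Fintype.card P ≤ Fintype.card Q) (σ : Equiv.Perm (Fin n)) (i : Fin n) :
    Fintype.card P ≤ (Finset.univ.filter (fun q : Slot Q => slotTeam σ q = i)).card := by
  have hlt : ∀ r : Fin (Fintype.card P), (r : ℕ) * n + (σ.symm i : Fin n) < Fintype.card Q := by
    intro r
    refine lt_of_lt_of_le ?_ hc
    have h1 : ((r : ℕ) + 1) * n ≤ Fintype.card P * n := Nat.mul_le_mul_right n r.2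
    have h2 := (σ.symm i).2
    rw [add_mul, one_mul] at h1
    rw [mul_comm n]
    omega
  have := Finset.card_le_card_of_injOn (s := (Finset.univ : Finset (Fin (Fintype.card P))))
    (t := Finset.univ.filter (fun q : Slot Q => slotTeam σ q = i))
    (fun r => ⟨(r : ℕ) * n + (σ.symm i : Fin n), hlt r⟩) (by
      intro r _
      refine Finset.mem_coe.2 (Finset.mem_filter.2 ⟨Finset.mem_univ _, ?_⟩)
      rw [slotTeam, ← Equiv.eq_symm_apply]
      ext
      simp [Nat.mul_add_mod_self_right, Nat.mod_eq_of_lt (σ.symm i).2]) (by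
      intro r _ r' _ hr
      simp only [Fin.mk.injEq, add_left_inj] at hr
      exact Fin.ext (Nat.eq_of_mul_eq_mul_right (NeZero.pos n) hr))
  simpa using this

/-- An improvement would be realized by a matching of the tight graph, where team values are fixed
and the rank sum of `μ` is minimal. -/
theorem IsPadding.pO [Fintype P] [Fintype Q] [NeZero n] {I : Market n P}
    {J : Market n Q} {ι : P → Q} (h : I.IsPadding J ι) (hb : I.IsBinary)
    (hc : n * Fintype.card P ≤ Fintype.card Q) {σ : Equiv.Perm (Fin n)} {μ : Slot Q ≃ Q}
    (hμ : J.IsLexMax σ μ) (hr : ∀ ν, J.InTight σ μ ν → J.rankSum σ μ ≤ J.rankSum σ ν)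
    (A : Alloc n P) (hA : ∀ p, A p = slotTeam σ (μ.symm (ι p))) : I.PO A := by
  classical
  rintro A' ⟨hteams, hplayers, hstrict⟩
  have hJ := h.isBinary hb
  -- the positions of team `i` that `μ` gives weight one
  let Z : Fin n → Finset (Slot Q) := fun i =>
    Finset.univ.filter (fun q => slotTeam σ q = i ∧ J.weight σ q (μ q) = 1)
  let V : Fin n → Finset P := fun i => (A'.part i).filter (fun p => I.v i p = 1)
  have hval : ∀ i, I.value i (A.part i) = (Z i).card := by
    intro i
    rw [h.value_part σ μ A hA, Finset.card_filter, Finset.sum_filter]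
    push_cast
    refine Finset.sum_congr rfl fun q _ => ?_
    by_cases hq : slotTeam σ q = i
    · rcases hJ (slotTeam σ q) (μ q) with h0 | h0 <;> simp [hq, weight, hq ▸ h0]
    · simp [hq]
  have hval' : ∀ i, I.value i (A'.part i) = (V i).card := by
    intro i
    rw [value, Finset.card_filter]
    push_cast
    refine Finset.sum_congr rfl fun p _ => ?_
    rcases hb i p with h0 | h0 <;> simp [h0]
  have hZV : ∀ i, (Z i).card ≤ (V i).card := by
    intro i
    have := hteams i
    rw [hval, hval'] at this
    exact_mod_cast this
  -- every team gets its players into its own positions, valuable players first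
  have hteam : ∀ i, ∃ g : P → Slot Q, Set.InjOn g (A'.part i) ∧
      (∀ p ∈ A'.part i, slotTeam σ (g p) = i) ∧ ∀ q ∈ Z i, ∃ p ∈ V i, g p = q := by
    intro i
    -- Exactly as many valuable players as there are positions to be filled in `Z i`; `e` places
    -- them.
    obtain ⟨W, hWV, hWc⟩ := Finset.exists_subset_card_eq (hZV i)
    obtain ⟨e⟩ : Nonempty (W ≃ Z i) := by
      rw [← Fintype.card_eq]
      simpa using hWc
    -- A default position `q₀` is needed off `W`; without positions there are no players either.
    by_cases hQ : IsEmpty (Slot Q)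
    · have hcard : Fintype.card P = 0 := by
        have : Fintype.card Q = 0 := by
          by_contra hne
          exact hQ.elim ⟨0, Nat.pos_of_ne_zero hne⟩
        rw [this] at hc
        have := NeZero.pos n
        rcases Nat.mul_eq_zero.1 (Nat.le_zero.1 hc) with h0 | h0
        · omega
        · exact h0
      have hP := Fintype.card_eq_zero_iff.1 hcard
      exact ⟨fun p => hP.elim p, fun p => hP.elim p, fun p => hP.elim p, fun q => hQ.elim q⟩
    rw [not_isEmpty_iff] at hQ
    obtain ⟨q₀⟩ := hQ
    obtain ⟨g, hg1, hg2, hg3⟩ := exists_injOn_extend (s₀ := W) (s := A'.part i)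
      (t := Finset.univ.filter (fun q : Slot Q => slotTeam σ q = i))
      (f := fun p => if hp : p ∈ W then (e ⟨p, hp⟩ : Slot Q) else q₀)
      (hWV.trans (Finset.filter_subset _ _))
      (by
        intro p hp
        have := (e ⟨p, hp⟩).2
        simp only [Z, Finset.mem_filter] at this
        simp only [dif_pos hp, Finset.mem_filter, Finset.mem_univ, true_and]
        exact this.2.1)
      (by
        intro a ha b hb hab
        have ha' : a ∈ W := ha
        have hb' : b ∈ W := hb
        simp only [dif_pos ha', dif_pos hb'] at hab
        exact congrArg Subtype.val (e.injective (Subtype.ext hab)))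
      ((Finset.card_le_univ _).trans (card_le_card_slots hc σ i))
    refine ⟨g, hg1, fun p hp => by simpa using hg2 p hp, fun q hq => ?_⟩
    refine ⟨e.symm ⟨q, hq⟩, hWV (e.symm ⟨q, hq⟩).2, ?_⟩
    rw [hg3 _ (e.symm ⟨q, hq⟩).2]
    simp
  choose g hg1 hg2 hg3 using hteam
  have hmem : ∀ p, p ∈ A'.part (A' p) := fun p => by simp [Alloc.part]
  obtain ⟨ν, hν⟩ := exists_slot_equiv h.inj (f := fun p => g (A' p) p) (by
    intro p p' hp
    have h1 := hg2 _ _ (hmem p)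
    have h2 := hg2 _ _ (hmem p')
    simp only at hp
    rw [hp, h2] at h1
    refine hg1 (A' p) (hmem p) (h1 ▸ hmem p') ?_
    rw [hp, h1])
  have hνA : ∀ p, A' p = slotTeam σ (ν.symm (ι p)) := fun p => by
    rw [hν]
    exact (hg2 _ _ (hmem p)).symm
  -- On positions of weight one, `ν` places a player of value one by `hg3`; elsewhere there is
  -- nothing to beat.
  have htight : J.InTight σ μ ν := by
    refine hμ.inTight_of_le fun q => ?_
    rcases hJ (slotTeam σ q) (μ q) with h0 | h0
    · rw [weight, h0, weight]
      rcases hJ (slotTeam σ q) (ν q) with h1 | h1 <;> simp [h1]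
    · obtain ⟨p, hp, hpq⟩ := hg3 (slotTeam σ q) q
        (Finset.mem_filter.2 ⟨Finset.mem_univ _, rfl, h0⟩)
      simp only [V, Alloc.part, Finset.mem_filter, Finset.mem_univ, true_and] at hp
      have : ν q = ι p := by
        rw [← Equiv.eq_symm_apply, hν, hp.1, hpq]
      rw [weight, h0, weight, this, h.v_apply, hp.2]
  have hle := hr ν htight
  rcases hstrict with ⟨i, hi⟩ | ⟨p, hp⟩
  · rw [h.value_part σ μ A hA, h.value_part σ ν A' hνA] at hi
    refine hi.ne (Finset.sum_congr rfl fun q _ => (htight q).symm)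
  · refine absurd hle (not_le.2 (Finset.sum_lt_sum (fun x _ => ?_) ⟨ι p, Finset.mem_univ _, ?_⟩))
    · by_cases hx : x ∈ Set.range ι
      · obtain ⟨p', rfl⟩ := hx
        rw [← hA, ← hνA, h.rank_apply, h.rank_apply]
        exact I.rank_le_of_pref (hplayers p')
      · rw [h.rank_dummy hx, h.rank_dummy hx]
    · rw [← hA, ← hνA, h.rank_apply, h.rank_apply]
      exact I.rank_lt_of_sPref hp

/-! ### Binary instances: the first phase does all the work. -/

theorem mem_plusPlayers [Fintype P] [NeZero n] {I : Market n P} (hb : I.IsBinary) (p : P) :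
    p ∈ I.plusPlayers := by
  simp only [plusPlayers, Finset.mem_filter, Finset.mem_univ, true_and]
  refine ⟨0, ?_⟩
  rcases hb 0 p with h0 | h0 <;> simp [h0]

theorem card_withDummies [Fintype P] [NeZero n] (S : Finset P) (hS : ∀ p, p ∈ S) :
    Fintype.card ({p // p ∈ S} ⊕ Fin (numDummies n S.card)) = n * Fintype.card P + n := by
  have : S = Finset.univ := Finset.eq_univ_iff_forall.2 hS
  subst this
  have hn : 1 ≤ n := NeZero.pos n
  rw [Fintype.card_sum, Fintype.card_coe, Fintype.card_fin, numDummies, Finset.card_univ]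
  obtain ⟨k, rfl⟩ := Nat.exists_eq_add_of_le hn
  rw [Nat.add_sub_cancel_left]
  ring

theorem AlgorithmOutput.eF1_and_pO [Fintype P] [DecidableEq P] [NeZero n] {I : Market n P}
    (hb : I.IsBinary) {A : Alloc n P} (h : I.AlgorithmOutput A) : I.EF1 A ∧ I.PO A := by
  obtain ⟨Aplus, -, ⟨μ, μ', h1, h2, h3, h4⟩, -, h5, -⟩ := h
  have hS := mem_plusPlayers hb
  have hpad := isPadding_withDummies I I.plusPlayers hS (numDummies n I.plusPlayers.card)
  have hlex := h1.of_inTight h2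
  have hA : ∀ p, A p = slotTeam (Equiv.refl _) (μ'.symm (Sum.inl ⟨p, hS p⟩)) := fun p => by
    rw [← h4]
    exact h5 ⟨p, hS p⟩
  refine ⟨hpad.eF1 hb hlex A hA, hpad.pO hb ?_ hlex (fun ν hν => h3 ν fun q => ?_) A hA⟩
  · rw [card_withDummies _ hS]
    exact Nat.le_add_right _ _
  · rw [hν q, h2 q]

end Market

namespace Market

variable {n : ℕ} {P Q : Type*}

/-! ### Optimal assignments give outputs of the matching procedure -/

theorem rank_le (I : Market n P) (p : P) (i : Fin n) : I.rank p i ≤ n := by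
  classical
  have h : (Finset.univ.filter (fun j => I.SPref p j i)).card <
      (Finset.univ : Finset (Fin n)).card := by
    refine Finset.card_lt_card (Finset.filter_ssubset.2 ⟨i, Finset.mem_univ _, fun h => ?_⟩)
    exact h.2 h.1
  rw [Finset.card_univ, Fintype.card_fin] at h
  have e : I.rank p i = 1 + (Finset.univ.filter (fun j => I.SPref p j i)).card := by
    unfold rank
    congr
  omega

theorem sum_two_pow_lt (K : ℕ) (b : Fin K → Prop) [DecidablePred b] :
    ∑ r, (if b r then 2 ^ (K - 1 - (r : ℕ)) else 0) < 2 ^ K := by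
  induction K with
  | zero => simp
  | succ K ih =>
    rw [Fin.sum_univ_succ]
    have h := ih (fun r => b r.succ)
    have e : ∀ r : Fin K, K + 1 - 1 - ((r.succ : Fin (K + 1)) : ℕ) = K - 1 - (r : ℕ) := fun r => by
      simp only [Fin.val_succ]
      omega
    simp only [e]
    have : (if b 0 then 2 ^ (K + 1 - 1 - ((0 : Fin (K + 1)) : ℕ)) else 0) ≤ 2 ^ K := by
      split_ifs <;> simp
    rw [pow_succ]
    omega

/-- The binary number of a lexicographically larger sequence is larger. -/
theorem sum_two_pow_lt_of_lex {K : ℕ} {b b' : Fin K → Prop} [DecidablePred b] [DecidablePred b']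
    {q : Fin K} (hr : ∀ r < q, (b r ↔ b' r)) (hb : ¬ b q) (hb' : b' q) :
    ∑ r, (if b r then 2 ^ (K - 1 - (r : ℕ)) else 0) <
      ∑ r, (if b' r then 2 ^ (K - 1 - (r : ℕ)) else 0) := by
  induction K with
  | zero => exact q.elim0
  | succ K ih =>
    rw [Fin.sum_univ_succ, Fin.sum_univ_succ]
    have e : ∀ r : Fin K, K + 1 - 1 - ((r.succ : Fin (K + 1)) : ℕ) = K - 1 - (r : ℕ) := fun r => by
      simp only [Fin.val_succ]
      omega
    simp only [e]
    rcases Fin.eq_zero_or_eq_succ q with rfl | ⟨q, rfl⟩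
    · have h := sum_two_pow_lt K (fun r => b r.succ)
      simp only [if_neg hb, if_pos hb', Fin.val_zero, Nat.sub_zero, Nat.add_sub_cancel]
      omega
    · have h := ih (b := fun r => b r.succ) (b' := fun r => b' r.succ) (q := q)
        (fun r h => hr r.succ (Fin.succ_lt_succ_iff.2 h)) hb hb'
      have h0 := hr 0 (Fin.succ_pos q)
      simp only [h0]
      omega

theorem IsBinary.eq_iff {I : Market n P} (hb : I.IsBinary) {i j : Fin n} {p p' : P} :
    I.v i p = I.v j p' ↔ (I.v i p = 1 ↔ I.v j p' = 1) := by
  rcases hb i p with h | h <;> rcases hb j p' with h' | h' <;> simp [h, h']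

open Classical in
/-- An assignment of the true players to positions that minimizes the sum of the ranks minus the sum
of the values, where values are scaled by powers of two that dominate the ranks and decrease along
the positions, extends to a matching that the procedure can choose. -/
theorem IsPadding.optimal_of_cost [Fintype P] [Fintype Q] [NeZero n] {I : Market n P}
    {J : Market n Q} {ι : P → Q} (h : I.IsPadding J ι) (hb : I.IsBinary) {σ : Equiv.Perm (Fin n)}
    {M B : ℕ} (hM : n * Fintype.card P < M) (c : P → Slot Q → ℕ)
    (hc : ∀ p q, c p q + 1 + M * (if I.v (slotTeam σ q) p = 1 then
      2 ^ (Fintype.card Q - 1 - (q : ℕ)) else 0) = I.rank p (slotTeam σ q) + B)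
    {μ : Slot Q ≃ Q}
    (hμ : ∀ ν : Slot Q ≃ Q, ∑ p, c p (μ.symm (ι p)) ≤ ∑ p, c p (ν.symm (ι p))) :
    J.IsLexMax σ μ ∧ ∀ ν, J.InTight σ μ ν → J.rankSum σ μ ≤ J.rankSum σ ν := by
  have hJ := h.isBinary hb
  -- `W` reads the weight sequence as a binary number with position 0 most significant; `R` is the
  -- rank sum of the true players.
  let W : (Slot Q ≃ Q) → ℕ := fun ν => ∑ q : Slot Q, if J.v (slotTeam σ q) (ν q) = 1 then
    2 ^ (Fintype.card Q - 1 - (q : ℕ)) else 0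
  let R : (Slot Q ≃ Q) → ℕ := fun ν => ∑ p, I.rank p (slotTeam σ (ν.symm (ι p)))
  have hsum : ∀ ν : Slot Q ≃ Q, ∑ p, c p (ν.symm (ι p)) + Fintype.card P + M * W ν =
      R ν + Fintype.card P * B := by
    intro ν
    have h1 := h.sum_slots ν (fun _ => True) (fun q x => if J.v (slotTeam σ q) x = 1 then
      2 ^ (Fintype.card Q - 1 - (q : ℕ)) else 0) (fun q x hx => by simp [h.v_dummy _ x hx])
    simp only [Finset.filter_true, h.v_apply] at h1
    have h2 := Finset.sum_congr rfl (fun p (_ : p ∈ (Finset.univ : Finset P)) =>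
      hc p (ν.symm (ι p)))
    rw [Finset.sum_add_distrib, Finset.sum_add_distrib, Finset.sum_add_distrib, ← Finset.mul_sum,
      h1] at h2
    simpa using h2
  have hopt : ∀ ν, R μ + M * W ν ≤ R ν + M * W μ := by
    intro ν
    have h1 := hsum μ
    have h2 := hsum ν
    have h3 := hμ ν
    omega
  refine ⟨fun q ν hν => ?_, fun ν hν => ?_⟩
  · by_contra hlt
    rw [not_le] at hlt
    have hw : J.v (slotTeam σ q) (μ q) = 0 ∧ J.v (slotTeam σ q) (ν q) = 1 := by
      unfold weight at hlt
      rcases hJ (slotTeam σ q) (μ q) with h1 | h1 <;> rcases hJ (slotTeam σ q) (ν q) with h2 | h2 <;>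
        rw [h1, h2] at hlt <;> norm_num at hlt
      exact ⟨h1, h2⟩
    -- A larger `W ν` would gain at least `M`, more than the whole rank sum `R ν` can cost.
    have hWlt : W μ < W ν := sum_two_pow_lt_of_lex (q := q)
      (b := fun q => J.v (slotTeam σ q) (μ q) = 1) (b' := fun q => J.v (slotTeam σ q) (ν q) = 1)
      (fun r hr => hJ.eq_iff.1 (hν r hr).symm) (by simp [hw.1]) hw.2
    have hR : R ν ≤ n * Fintype.card P := by
      have := Finset.sum_le_card_nsmul Finset.univ (fun p => I.rank p (slotTeam σ (ν.symm (ι p)))) n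
        (fun p _ => I.rank_le p _)
      simpa [mul_comm] using this
    have h1 := hopt ν
    have h2 : M * (W μ + 1) ≤ M * W ν := Nat.mul_le_mul_left M hWlt
    rw [mul_add, mul_one] at h2
    omega
  · have hW : W μ = W ν := by
      refine Finset.sum_congr rfl fun q _ => ?_
      have := hν q
      unfold weight at this
      rw [this]
    have h1 := hopt ν
    rw [hW] at h1
    have hR : R μ ≤ R ν := by omega
    -- All dummies have rank one, so they add the same constant to every rank sum.
    have hsplit : ∀ τ : Slot Q ≃ Q, J.rankSum σ τ = R τ + (Finset.univ \ Finset.univ.image ι).card := by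
      intro τ
      rw [rankSum, ← Finset.sum_sdiff (Finset.subset_univ (Finset.univ.image ι)), add_comm,
        Finset.sum_image (fun p _ p' _ hp => h.inj hp), Finset.card_eq_sum_ones]
      congr 1
      · exact Finset.sum_congr rfl fun p _ => h.rank_apply p _
      · refine Finset.sum_congr rfl fun x hx => h.rank_dummy ?_ _
        simpa using hx
    rw [hsplit, hsplit]
    omega

/-- One optimal matching serves as both `μ` and `μ'` of the procedure. -/
theorem exists_roundRobinOutput_of_cost [Fintype P] [Fintype Q] [NeZero n] {I : Market n P}
    {J : Market n Q} {ι : P → Q} (h : I.IsPadding J ι) (hb : I.IsBinary) {σ : Equiv.Perm (Fin n)}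
    {M B : ℕ} (hM : n * Fintype.card P < M) (c : P → Slot Q → ℕ)
    (hc0 : ∀ p q, I.v (slotTeam σ q) p = 0 → c p q + 1 = I.rank p (slotTeam σ q) + B)
    (hc1 : ∀ p q, I.v (slotTeam σ q) p = 1 →
      c p q + 1 + M * 2 ^ (Fintype.card Q - 1 - (q : ℕ)) = I.rank p (slotTeam σ q) + B)
    {f : P → Slot Q} (hf : Function.Injective f)
    (hmin : ∀ g : P → Slot Q, Function.Injective g → ∑ p, c p (f p) ≤ ∑ p, c p (g p)) :
    ∃ A : Alloc n Q, J.RoundRobinOutput σ A ∧ ∀ p, A (ι p) = slotTeam σ (f p) := by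
  classical
  obtain ⟨μ, hμ⟩ := exists_slot_equiv h.inj hf
  have hopt := h.optimal_of_cost hb (σ := σ) (B := B) (μ := μ) hM c (fun p q => by
    rcases hb (slotTeam σ q) p with h0 | h0
    · simpa [h0] using hc0 p q h0
    · simpa [h0] using hc1 p q h0) (fun ν => by
    simp only [hμ]
    exact hmin (fun p => ν.symm (ι p)) (ν.symm.injective.comp h.inj))
  exact ⟨fun x => slotTeam σ (μ.symm x), ⟨μ, μ, hopt.1, fun q => rfl, hopt.2, fun _ => rfl⟩,
    fun p => congrArg (slotTeam σ) (hμ p)⟩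

/-- Used for the phase on P⁻: all weights are equal and so are all ranks, so any matching is
admissible. -/
theorem roundRobinOutput_of_forall_dummy [Fintype Q] [NeZero n] {J : Market n Q}
    (hv : ∀ i x, J.v i x = 0) (hp : ∀ x i j, J.pref x i j) (σ : Equiv.Perm (Fin n))
    (ν : Slot Q ≃ Q) : J.RoundRobinOutput σ (fun x => slotTeam σ (ν.symm x)) := by
  refine ⟨ν, ν, fun q τ _ => by simp [weight, hv], fun _ => rfl, fun τ _ => ?_, fun _ => rfl⟩
  simp [rankSum, rank, SPref, hp]

theorem not_mem_minusPlayers [Fintype P] [NeZero n] {I : Market n P} (hb : I.IsBinary) (p : P) :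
    p ∉ I.minusPlayers := by
  simp only [minusPlayers, Finset.mem_filter, Finset.mem_univ, true_and, not_forall, not_lt]
  refine ⟨0, ?_⟩
  rcases hb 0 p with h0 | h0 <;> simp [h0]

/-- The interface to the program: positions become plain natural numbers, and all that remains is an
assignment problem. -/
theorem algorithmOutput_of_cost [Fintype P] [NeZero n] {I : Market n P} (hb : I.IsBinary)
    {M B : ℕ} (hM : n * Fintype.card P < M) (c : P → ℕ → ℕ)
    (hc0 : ∀ p q, q < n * Fintype.card P + n → I.v (Fin.ofNat n q) p = 0 →
      c p q + 1 = I.rank p (Fin.ofNat n q) + B)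
    (hc1 : ∀ p q, q < n * Fintype.card P + n → I.v (Fin.ofNat n q) p = 1 →
      c p q + 1 + M * 2 ^ (n * Fintype.card P + n - 1 - q) = I.rank p (Fin.ofNat n q) + B)
    {f : P → ℕ} (hfK : ∀ p, f p < n * Fintype.card P + n) (hf : Function.Injective f)
    (hmin : ∀ g : P → ℕ, (∀ p, g p < n * Fintype.card P + n) → Function.Injective g →
      ∑ p, c p (f p) ≤ ∑ p, c p (g p)) :
    I.AlgorithmOutput (fun p => Fin.ofNat n (f p)) := by
  have hS := mem_plusPlayers hb
  have hpad := isPadding_withDummies I I.plusPlayers hS (numDummies n I.plusPlayers.card)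
  have hcard := card_withDummies (n := n) I.plusPlayers hS
  obtain ⟨A, hA, hAf⟩ := exists_roundRobinOutput_of_cost (σ := Equiv.refl _) hpad hb hM
    (fun p q => c p q) (B := B)
    (fun p q h0 => hc0 p q (hcard ▸ q.2) h0)
    (fun p q h0 => by
      have := hc1 p q (hcard ▸ q.2) h0
      rwa [← hcard] at this)
    (f := fun p => ⟨f p, hcard ▸ hfK p⟩) (fun p p' hp => hf (Fin.mk.inj_iff.1 hp))
    (fun g hg => hmin (fun p => g p) (fun p => hcard ▸ (g p).2)
      (fun p p' hp => hg (Fin.ext hp)))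
  refine ⟨A, _, hA, roundRobinOutput_of_forall_dummy ?_ ?_ Fin.revPerm
    (Fintype.equivFin _).symm, fun p => (hAf p).symm, fun p => absurd p.2 (not_mem_minusPlayers hb _)⟩
  · rintro i (p | p)
    · exact absurd p.2 (not_mem_minusPlayers hb _)
    · rfl
  · rintro (p | p) i j
    · exact absurd p.2 (not_mem_minusPlayers hb _)
    · trivial

end Market

/-! ### The Hungarian method

The rows `i < m` are assigned to the columns `j < K` one after the other. All numbers are natural:
the dual variables `u`, `v` satisfy `u i ≤ C i j + v j`. -/

namespace Hungarian

/-- The rows below `r` are assigned by `mate` to distinct columns, those with `used j ≠ 0`, and the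
dual variables `u`, `v` certify that the assignment is optimal. -/
structure Dual (C : ℕ → ℕ → ℕ) (m K r : ℕ) (u v mate used : ℕ → ℕ) : Prop where
  feas : ∀ i < m, ∀ j < K, u i ≤ C i j + v j
  mate_lt : ∀ i < r, mate i < K
  inj : ∀ i < r, ∀ i' < r, mate i = mate i' → i = i'
  tight : ∀ i < r, u i = C i (mate i) + v (mate i)
  used_iff : ∀ j < K, used j ≠ 0 ↔ ∃ i < r, mate i = j
  -- Complementary slackness for the columns.
  free : ∀ j < K, used j = 0 → v j = 0

/-- The row `r` sits in the virtual column `K`, and the columns with `tree j = 1` are reached from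
it by alternating paths of tight edges; the path to column `j` comes from row `way j`. The column
`j₀` was reached last, and `ord` counts the steps. -/
structure Tree (C : ℕ → ℕ → ℕ) (m K r : ℕ) (u v mate used tree way ord : ℕ → ℕ) (j₀ : ℕ) : Prop
    extends Dual C m K r u v mate used where
  mate_row : mate r = K
  used_K : used K ≠ 0
  tree_K : tree K = 1
  tree_j₀ : tree j₀ = 1
  j₀_le : j₀ ≤ K
  tree_le : ∀ j ≤ K, tree j ≤ 1
  way_le : ∀ j < K, tree j = 1 → way j ≤ r
  tree_way : ∀ j < K, tree j = 1 → tree (mate (way j)) = 1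
  ord_way : ∀ j < K, tree j = 1 → ord (mate (way j)) < ord j
  way_tight : ∀ j < K, tree j = 1 → u (way j) = C (way j) j + v j
  tree_used : ∀ j < K, tree j = 1 → j ≠ j₀ → used j ≠ 0
  ord_le : ∀ j ≤ K, tree j = 1 → ord j ≤ ord j₀

/-- The path from `r` is being flipped: the rows up to `r` are assigned to the columns `j` with
`used j ≠ 0` other than `j₀`. -/
structure Flip (C : ℕ → ℕ → ℕ) (m K r : ℕ) (u v mate used tree way ord : ℕ → ℕ) (j₀ : ℕ) :
    Prop where
  feas : ∀ i < m, ∀ j < K, u i ≤ C i j + v j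
  mate_le : ∀ i ≤ r, mate i ≤ K
  inj : ∀ i ≤ r, ∀ i' ≤ r, mate i = mate i' → i = i'
  tight : ∀ i ≤ r, mate i < K → u i = C i (mate i) + v (mate i)
  mate_ne : ∀ i ≤ r, mate i ≠ j₀
  used_iff : ∀ j ≤ K, used j ≠ 0 ↔ j = j₀ ∨ ∃ i ≤ r, mate i = j
  free : ∀ j < K, used j = 0 → v j = 0
  tree_j₀ : tree j₀ = 1
  j₀_le : j₀ ≤ K
  way_le : ∀ j < K, tree j = 1 → way j ≤ r
  -- Flipping changes `mate` at rows already passed, so only columns reached no later than `j₀` keep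
  -- their path back to the root.
  tree_way : ∀ j < K, tree j = 1 → ord j ≤ ord j₀ → tree (mate (way j)) = 1
  ord_way : ∀ j < K, tree j = 1 → ord j ≤ ord j₀ → ord (mate (way j)) < ord j
  way_tight : ∀ j < K, tree j = 1 → u (way j) = C (way j) j + v j

/-- The number of columns that are not in the tree. -/
def numOutside (K : ℕ) (tree : ℕ → ℕ) : ℕ :=
  ((Finset.range K).filter (fun j => tree j = 0)).card

theorem numOutside_le (K : ℕ) (tree : ℕ → ℕ) : numOutside K tree ≤ K :=
  (Finset.card_filter_le _ _).trans (Finset.card_range K).le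

theorem numOutside_update {K : ℕ} {tree : ℕ → ℕ} {j : ℕ} (hj : j < K) (ht : tree j = 0) :
    numOutside K (Function.update tree j 1) + 1 = numOutside K tree := by
  have : (Finset.range K).filter (fun k => Function.update tree j 1 k = 0) =
      ((Finset.range K).filter (fun k => tree k = 0)).erase j := by
    ext k
    by_cases hk : k = j
    · simp [hk]
    · simp [hk]
  rw [numOutside, this, numOutside]
  exact Finset.card_erase_add_one (by simp [hj, ht])

section

variable {C : ℕ → ℕ → ℕ} {m K r : ℕ} {u v mate used tree way ord : ℕ → ℕ} {j₀ : ℕ}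

theorem Dual.init (C : ℕ → ℕ → ℕ) (m K : ℕ) {u v used : ℕ → ℕ} (mate : ℕ → ℕ)
    (hu : ∀ i, u i = 0) (hv : ∀ j, v j = 0) (hused : ∀ j, used j = 0) :
    Dual C m K 0 u v mate used where
  feas i _ j _ := by simp [hu]
  mate_lt := by simp
  inj := by simp
  tight := by simp
  used_iff := by simp [hused]
  free := by simp [hv]

theorem Dual.exists_unused (h : Dual C m K r u v mate used) (hr : r < K) :
    ∃ j < K, used j = 0 := by
  by_contra hcon
  push Not at hcon
  have hsub : Finset.range K ⊆ (Finset.range r).image mate := fun j hj => by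
    rw [Finset.mem_range] at hj
    obtain ⟨i, hi, hij⟩ := (h.used_iff j hj).1 (hcon j hj)
    exact Finset.mem_image.2 ⟨i, Finset.mem_range.2 hi, hij⟩
  have := (Finset.card_le_card hsub).trans Finset.card_image_le
  simp only [Finset.card_range] at this
  omega

/-- Weak duality: the assignment is optimal. -/
theorem Dual.sum_le (h : Dual C m K m u v mate used) {g : Fin m → ℕ} (hgK : ∀ i, g i < K)
    (hg : Function.Injective g) : ∑ i : Fin m, C i (mate i) ≤ ∑ i : Fin m, C i (g i) := by
  have h1 : ∑ i : Fin m, u i = ∑ i : Fin m, C i (mate i) + ∑ i : Fin m, v (mate i) := by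
    rw [← Finset.sum_add_distrib]
    exact Finset.sum_congr rfl fun i _ => h.tight i i.2
  have h2 : ∑ i : Fin m, u i ≤ ∑ i : Fin m, C i (g i) + ∑ i : Fin m, v (g i) := by
    rw [← Finset.sum_add_distrib]
    exact Finset.sum_le_sum fun i _ => h.feas i i.2 _ (hgK i)
  -- `v` vanishes on unused columns, so the assigned columns carry its whole sum; no injection can
  -- collect more.
  have h3 : ∑ i : Fin m, v (mate i) = ∑ j ∈ Finset.range K, v j := by
    rw [← Finset.sum_image (f := v) (g := fun i : Fin m => mate i)
      (fun i _ i' _ hi => Fin.ext (h.inj i i.2 i' i'.2 hi))]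
    refine Finset.sum_subset (fun j hj => ?_) (fun j hj hj' => ?_)
    · obtain ⟨i, _, rfl⟩ := Finset.mem_image.1 hj
      exact Finset.mem_range.2 (h.mate_lt i i.2)
    · refine h.free j (Finset.mem_range.1 hj) ?_
      by_contra hne
      obtain ⟨i, hi, hij⟩ := (h.used_iff j (Finset.mem_range.1 hj)).1 hne
      exact hj' (Finset.mem_image.2 ⟨⟨i, hi⟩, Finset.mem_univ _, hij⟩)
  have h4 : ∑ i : Fin m, v (g i) ≤ ∑ j ∈ Finset.range K, v j := by
    rw [← Finset.sum_image (f := v) (g := g) (fun i _ i' _ hi => hg hi)]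
    refine Finset.sum_le_sum_of_subset fun j hj => ?_
    obtain ⟨i, _, rfl⟩ := Finset.mem_image.1 hj
    exact Finset.mem_range.2 (hgK i)
  omega

/-- With row `r` matched to a virtual column `K`, the tree starts at a column, and each later column
is attached to the mate of its row `way j`. -/
theorem Dual.toTree (h : Dual C m K r u v mate used) (htree : ∀ j < K, tree j = 0)
    (htree_K : tree K = 1) (way : ℕ → ℕ) :
    Tree C m K r u v (Function.update mate r K) (Function.update used K 1) tree way
      (fun _ => 0) K where
  feas := h.feas
  mate_lt i hi := by simpa [hi.ne] using h.mate_lt i hi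
  inj i hi i' hi' := by simpa [hi.ne, hi'.ne] using h.inj i hi i' hi'
  tight i hi := by simpa [hi.ne] using h.tight i hi
  used_iff j hj := by
    rw [Function.update_of_ne hj.ne, h.used_iff j hj]
    refine exists_congr fun i => and_congr_right fun hi => ?_
    rw [Function.update_of_ne hi.ne]
  free j hj := by simpa [hj.ne] using h.free j hj
  mate_row := by simp
  used_K := by simp
  tree_K := htree_K
  tree_j₀ := htree_K
  j₀_le := le_rfl
  tree_le j hj := by
    rcases hj.lt_or_eq with hj | rfl
    · simp [htree j hj]
    · exact htree_K.le
  way_le j hj := by simp [htree j hj]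
  tree_way j hj := by simp [htree j hj]
  ord_way j hj := by simp [htree j hj]
  way_tight j hj := by simp [htree j hj]
  tree_used j hj := by simp [htree j hj]
  ord_le := by simp

theorem Tree.mate_le (h : Tree C m K r u v mate used tree way ord j₀) {i : ℕ} (hi : i ≤ r) :
    mate i ≤ K := by
  rcases hi.lt_or_eq with hi | rfl
  · exact (h.mate_lt i hi).le
  · exact h.mate_row.le

/-- If the tree contained all columns, all of them would be used, although only `r < K` rows are
assigned. So there is a slack to minimize. -/
theorem Tree.exists_outside (h : Tree C m K r u v mate used tree way ord j₀) (hr : r < K)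
    (hj₀ : used j₀ ≠ 0) : ∃ j < K, tree j = 0 := by
  obtain ⟨j, hj, hu⟩ := h.exists_unused hr
  refine ⟨j, hj, ?_⟩
  have h1 := h.tree_le j hj.le
  by_contra hne
  exact h.tree_used j hj (by omega) (fun e => hj₀ (e ▸ hu)) hu

/-- The dual variables are raised by `δ` in the tree, and the column `bj` is added. -/
theorem Tree.step (h : Tree C m K r u v mate used tree way ord j₀) (hj₀ : used j₀ ≠ 0)
    {bi bj δ : ℕ} (hbi : bi ≤ r) (hbit : tree (mate bi) = 1) (hbj : bj < K) (hbjt : tree bj = 0)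
    (hδ : u bi + δ = C bi bj + v bj)
    (hmin : ∀ i ≤ r, tree (mate i) = 1 → ∀ j < K, tree j = 0 → u i + δ ≤ C i j + v j)
    {u' v' : ℕ → ℕ}
    (hu' : ∀ i, u' i = u i + if i ≤ r ∧ tree (mate i) = 1 then δ else 0)
    (hv' : ∀ j, v' j = v j + if j < K ∧ tree j = 1 then δ else 0) :
    Tree C m K r u' v' mate used (Function.update tree bj 1) (Function.update way bj bi)
      (Function.update ord bj (ord j₀ + 1)) bj := by
  have hne : ∀ j, tree j = 1 → j ≠ bj := fun j hj e => by
    rw [e, hbjt] at hj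
    exact zero_ne_one hj
  refine
    { feas := fun i hi j hj => ?_
      mate_lt := h.mate_lt
      inj := h.inj
      tight := fun i hi => ?_
      used_iff := h.used_iff
      free := fun j hj hu => ?_
      mate_row := h.mate_row
      used_K := h.used_K
      tree_K := ?_
      tree_j₀ := ?_
      j₀_le := hbj.le
      tree_le := fun j hj => ?_
      way_le := fun j hj ht => ?_
      tree_way := fun j hj ht => ?_
      ord_way := fun j hj ht => ?_
      way_tight := fun j hj ht => ?_
      tree_used := fun j hj ht hjb => ?_
      ord_le := fun j hj ht => ?_ }
  -- Only a tree row facing a column outside the tree loses slack, and there `δ` is at most the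
  -- slack.
  · have h1 := h.feas i hi j hj
    rw [hu', hv']
    have h2 := h.tree_le j hj.le
    split_ifs with h3 h4
    · omega
    · exact hmin i h3.1 h3.2 j hj (by
        by_contra hne
        exact h4 ⟨hj, by omega⟩)
    · omega
    · omega
  -- An assigned row and its column are raised together or not at all.
  · have h1 := h.tight i hi
    have h2 := h.mate_lt i hi
    rw [hu', hv']
    by_cases ht : tree (mate i) = 1
    · rw [if_pos ⟨hi.le, ht⟩, if_pos ⟨h2, ht⟩]
      omega
    · rw [if_neg (fun h => ht h.2), if_neg (fun h => ht h.2)]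
      omega
  · rw [hv', h.free j hj hu, if_neg]
    rintro ⟨-, ht⟩
    exact h.tree_used j hj ht (fun e => hj₀ (e ▸ hu)) hu
  · rw [Function.update_of_ne hbj.ne', h.tree_K]
  · simp
  · by_cases e : j = bj
    · simp [e]
    · simpa [e] using h.tree_le j hj
  · by_cases e : j = bj
    · simpa [e] using hbi
    · rw [Function.update_of_ne e] at ht ⊢
      exact h.way_le j hj ht
  · by_cases e : j = bj
    · rw [e, Function.update_self, Function.update_of_ne (hne _ hbit), hbit]
    · rw [Function.update_of_ne e] at ht ⊢
      have := h.tree_way j hj ht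
      rw [Function.update_of_ne (hne _ this), this]
  · by_cases e : j = bj
    · rw [e, Function.update_self, Function.update_of_ne (hne _ hbit), Function.update_self]
      exact Nat.lt_succ_of_le (h.ord_le _ (h.mate_le hbi) hbit)
    · rw [Function.update_of_ne e] at ht ⊢
      rw [Function.update_of_ne (hne _ (h.tree_way j hj ht)), Function.update_of_ne e]
      exact h.ord_way j hj ht
  · by_cases e : j = bj
    · subst e
      rw [Function.update_self, hu', hv', if_pos ⟨hbi, hbit⟩, if_neg (by simp [hbjt])]
      omega
    · rw [Function.update_of_ne e] at ht ⊢
      have h1 := h.way_tight j hj ht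
      rw [hu', hv', if_pos ⟨h.way_le j hj ht, h.tree_way j hj ht⟩, if_pos ⟨hj, ht⟩]
      omega
  · rw [Function.update_of_ne hjb] at ht
    by_cases e : j = j₀
    · exact e ▸ hj₀
    · exact h.tree_used j hj ht e
  · rw [Function.update_self]
    by_cases e : j = bj
    · simp [e]
    · rw [Function.update_of_ne e] at ht ⊢
      have := h.ord_le j hj ht
      omega

/-- Counting the virtual column, one more column is marked than there are places occupied by the
rows up to `r`; the surplus one is `j₀`. -/
theorem Tree.flip (h : Tree C m K r u v mate used tree way ord j₀) (hj₀ : used j₀ = 0) :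
    Flip C m K r u v mate (Function.update used j₀ 1) tree way ord j₀ := by
  have hlt : j₀ < K := h.j₀_le.lt_of_ne fun e => h.used_K (e ▸ hj₀)
  refine
    { feas := h.feas
      mate_le := fun i hi => h.mate_le hi
      inj := fun i hi i' hi' e => ?_
      tight := fun i hi hK => ?_
      mate_ne := fun i hi e => ?_
      used_iff := fun j hj => ?_
      free := fun j hj hu => ?_
      tree_j₀ := h.tree_j₀
      j₀_le := h.j₀_le
      way_le := h.way_le
      tree_way := fun j hj ht _ => h.tree_way j hj ht
      ord_way := fun j hj ht _ => h.ord_way j hj ht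
      way_tight := h.way_tight }
  · rcases hi.lt_or_eq with hi | rfl <;> rcases hi'.lt_or_eq with hi' | rfl
    · exact h.inj i hi i' hi' e
    · exact absurd (e.trans h.mate_row) (h.mate_lt i hi).ne
    · exact absurd (e.symm.trans h.mate_row) (h.mate_lt i' hi').ne
    · rfl
  · rcases hi.lt_or_eq with hi | rfl
    · exact h.tight i hi
    · exact absurd h.mate_row hK.ne
  · rcases hi.lt_or_eq with hi | rfl
    · exact (h.used_iff j₀ hlt).2 ⟨i, hi, e⟩ hj₀
    · exact hlt.ne (e.symm.trans h.mate_row)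
  · by_cases e : j = j₀
    · simp [e]
    rw [Function.update_of_ne e]
    simp only [e, false_or]
    rcases hj.lt_or_eq with hj | rfl
    · rw [h.used_iff j hj]
      refine ⟨fun ⟨i, hi, hij⟩ => ⟨i, hi.le, hij⟩, fun ⟨i, hi, hij⟩ => ⟨i, ?_, hij⟩⟩
      refine hi.lt_of_ne fun e' => ?_
      subst e'
      exact hj.ne (hij.symm.trans h.mate_row)
    · simp only [h.used_K, ne_eq, not_false_eq_true, true_iff]
      exact ⟨r, le_rfl, h.mate_row⟩
  · by_cases e : j = j₀
    · simp [e] at hu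
    · rw [Function.update_of_ne e] at hu
      exact h.free j hj hu

theorem Flip.ord_mate_lt (h : Flip C m K r u v mate used tree way ord j₀) (hj₀ : j₀ < K) :
    ord (mate (way j₀)) < ord j₀ :=
  h.ord_way j₀ hj₀ h.tree_j₀ le_rfl

/-- Row `way j₀` moves to `j₀` along a tight edge, and the column it vacates becomes the surplus
one. Its `ord` is smaller, so the process ends. -/
theorem Flip.step (h : Flip C m K r u v mate used tree way ord j₀) (hj₀ : j₀ < K) :
    Flip C m K r u v (Function.update mate (way j₀) j₀) used tree way ord (mate (way j₀)) := by
  have hi₀ := h.way_le j₀ hj₀ h.tree_j₀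
  have hord := h.ord_mate_lt hj₀
  -- A column reached no later than the vacated one cannot hang on the row just moved, since it
  -- would have been reached after that row's old column.
  have key : ∀ j < K, tree j = 1 → ord j ≤ ord (mate (way j₀)) → way j ≠ way j₀ := by
    intro j hj ht ho e
    have := h.ord_way j hj ht (ho.trans hord.le)
    rw [e] at this
    omega
  refine
    { feas := h.feas
      mate_le := fun i hi => ?_
      inj := fun i hi i' hi' e => ?_
      tight := fun i hi hK => ?_
      mate_ne := fun i hi e => ?_
      used_iff := fun j hj => ?_
      free := h.free
      tree_j₀ := h.tree_way j₀ hj₀ h.tree_j₀ le_rfl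
      j₀_le := h.mate_le _ hi₀
      way_le := h.way_le
      tree_way := fun j hj ht ho => ?_
      ord_way := fun j hj ht ho => ?_
      way_tight := h.way_tight }
  · by_cases e : i = way j₀
    · simp [e, hj₀.le]
    · simpa [e] using h.mate_le i hi
  · by_cases e1 : i = way j₀ <;> by_cases e2 : i' = way j₀
    · rw [e1, e2]
    · rw [e1, Function.update_self, Function.update_of_ne e2] at e
      exact absurd e.symm (h.mate_ne i' hi')
    · rw [e2, Function.update_self, Function.update_of_ne e1] at e
      exact absurd e (h.mate_ne i hi)
    · rw [Function.update_of_ne e1, Function.update_of_ne e2] at e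
      exact h.inj i hi i' hi' e
  · by_cases e : i = way j₀
    · rw [e, Function.update_self]
      exact h.way_tight j₀ hj₀ h.tree_j₀
    · rw [Function.update_of_ne e] at hK ⊢
      exact h.tight i hi hK
  · by_cases e1 : i = way j₀
    · rw [e1, Function.update_self] at e
      rw [← e] at hord
      exact lt_irrefl _ hord
    · rw [Function.update_of_ne e1] at e
      exact e1 (h.inj i hi _ hi₀ e)
  · rw [h.used_iff j hj]
    constructor
    · rintro (rfl | ⟨i, hi, hij⟩)
      · exact Or.inr ⟨way j, hi₀, by simp⟩
      · by_cases e : i = way j₀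
        · exact Or.inl (e ▸ hij.symm)
        · exact Or.inr ⟨i, hi, by rw [Function.update_of_ne e, hij]⟩
    · rintro (rfl | ⟨i, hi, hij⟩)
      · exact Or.inr ⟨way j₀, hi₀, rfl⟩
      · by_cases e : i = way j₀
        · rw [e, Function.update_self] at hij
          exact Or.inl hij.symm
        · rw [Function.update_of_ne e] at hij
          exact Or.inr ⟨i, hi, hij⟩
  · rw [Function.update_of_ne (key j hj ht ho)]
    exact h.tree_way j hj ht (ho.trans hord.le)
  · rw [Function.update_of_ne (key j hj ht ho)]
    exact h.ord_way j hj ht (ho.trans hord.le)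

/-- When the surplus column is the virtual one, no row is left there. -/
theorem Flip.dual (h : Flip C m K r u v mate used tree way ord j₀) (hj₀ : j₀ = K) :
    Dual C m K (r + 1) u v mate used := by
  subst hj₀
  have hlt : ∀ i < r + 1, mate i < j₀ := fun i hi =>
    (h.mate_le i (Nat.lt_succ_iff.1 hi)).lt_of_ne (h.mate_ne i (Nat.lt_succ_iff.1 hi))
  exact
    { feas := h.feas
      mate_lt := hlt
      inj := fun i hi i' hi' => h.inj i (Nat.lt_succ_iff.1 hi) i' (Nat.lt_succ_iff.1 hi')
      tight := fun i hi => h.tight i (Nat.lt_succ_iff.1 hi) (hlt i hi)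
      used_iff := fun j hj => by
        rw [h.used_iff j hj.le]
        simp [hj.ne]
      free := h.free }

end

end Hungarian

/-! ### Reasoning about programs -/

@[simp] theorem Store.setReg_reg (s : Store) (x k y : ℕ) :
    (s.setReg x k).reg y = if y = x then k else s.reg y := by
  simp [Store.setReg, Function.update_apply]

@[simp] theorem Store.setReg_arr (s : Store) (x k : ℕ) : (s.setReg x k).arr = s.arr := rfl

@[simp] theorem Store.setArr_reg (s : Store) (a i k : ℕ) : (s.setArr a i k).reg = s.reg := rfl

@[simp] theorem Store.setArr_arr (s : Store) (a i k b : ℕ) :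
    (s.setArr a i k).arr b = if b = a then Function.update (s.arr a) i k else s.arr b := by
  simp [Store.setArr, Function.update_apply]

namespace RExpr

variable (s : Store) (e₁ e₂ : RExpr)

@[simp] theorem eval_const (k : ℕ) : (const k).eval s = k := by
  rw [eval]

@[simp] theorem eval_reg (x : ℕ) : (reg x).eval s = s.reg x := by
  rw [eval]

@[simp] theorem eval_load (a : ℕ) : (load a e₁).eval s = s.arr a (e₁.eval s) := by
  rw [eval]

@[simp] theorem eval_add : (add e₁ e₂).eval s = e₁.eval s + e₂.eval s := by
  rw [eval]

@[simp] theorem eval_sub : (sub e₁ e₂).eval s = e₁.eval s - e₂.eval s := by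
  rw [eval]

@[simp] theorem eval_lt : (lt e₁ e₂).eval s = if e₁.eval s < e₂.eval s then 1 else 0 := by
  rw [eval]

@[simp] theorem eval_eq : (eq e₁ e₂).eval s = if e₁.eval s = e₂.eval s then 1 else 0 := by
  rw [eval]

end RExpr

/-- Whether a program contains an assignment to register `x`. -/
def Prog.writesReg : Prog → ℕ → Bool
  | .skip, _ => false
  | .assign y _, x => x == y
  | .store _ _ _, _ => false
  | .seq c₁ c₂, x => c₁.writesReg x || c₂.writesReg x
  | .ite _ c₁ c₂, x => c₁.writesReg x || c₂.writesReg x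
  | .loop _ c, x => c.writesReg x

/-- Whether a program contains an assignment to array `a`. -/
def Prog.writesArr : Prog → ℕ → Bool
  | .skip, _ => false
  | .assign _ _, _ => false
  | .store b _ _, a => a == b
  | .seq c₁ c₂, a => c₁.writesArr a || c₂.writesArr a
  | .ite _ c₁ c₂, a => c₁.writesArr a || c₂.writesArr a
  | .loop _ c, a => c.writesArr a

/-- The memory `s'` agrees with `s` on all registers and arrays that `c` does not write to. -/
structure Frame (c : Prog) (s s' : Store) : Prop where
  reg : ∀ x, c.writesReg x = false → s'.reg x = s.reg x
  arr : ∀ a, c.writesArr a = false → s'.arr a = s.arr a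

/-- The frame rule. Its side conditions are computed from the syntax of the program, so for concrete
programs they are closed by `rfl`. -/
theorem Exec.frame {c : Prog} {s s' : Store} {t : ℕ} (h : Exec c s t s') : Frame c s s' := by
  induction h with
  | skip s => exact ⟨fun _ _ => rfl, fun _ _ => rfl⟩
  | assign x e s =>
    refine ⟨fun y hy => ?_, fun _ _ => rfl⟩
    have : y ≠ x := by simpa [Prog.writesReg] using hy
    simp [this]
  | store a idx e s =>
    refine ⟨fun _ _ => rfl, fun b hb => ?_⟩
    have : b ≠ a := by simpa [Prog.writesArr] using hb
    simp [this]
  | seq _ _ ih₁ ih₂ =>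
    refine ⟨fun y hy => ?_, fun b hb => ?_⟩
    · simp only [Prog.writesReg, Bool.or_eq_false_iff] at hy
      rw [ih₂.reg y hy.2, ih₁.reg y hy.1]
    · simp only [Prog.writesArr, Bool.or_eq_false_iff] at hb
      rw [ih₂.arr b hb.2, ih₁.arr b hb.1]
  | ite_true _ _ ih =>
    refine ⟨fun y hy => ?_, fun b hb => ?_⟩
    · simp only [Prog.writesReg, Bool.or_eq_false_iff] at hy
      exact ih.reg y hy.1
    · simp only [Prog.writesArr, Bool.or_eq_false_iff] at hb
      exact ih.arr b hb.1
  | ite_false _ _ ih =>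
    refine ⟨fun y hy => ?_, fun b hb => ?_⟩
    · simp only [Prog.writesReg, Bool.or_eq_false_iff] at hy
      exact ih.reg y hy.2
    · simp only [Prog.writesArr, Bool.or_eq_false_iff] at hb
      exact ih.arr b hb.2
  | loop_done _ => exact ⟨fun _ _ => rfl, fun _ _ => rfl⟩
  | loop_step _ _ _ ih₁ ih₂ =>
    refine ⟨fun y hy => ?_, fun b hb => ?_⟩
    · rw [ih₂.reg y hy, ih₁.reg y hy]
    · rw [ih₂.arr b hb, ih₁.arr b hb]

/-- The program `c`, started in memory `s`, halts after at most `T` steps in a memory with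
property `R`. -/
def Run (c : Prog) (s : Store) (T : ℕ) (R : Store → Prop) : Prop :=
  ∃ t s', Exec c s t s' ∧ t ≤ T ∧ R s'

namespace Run

variable {c c₁ c₂ : Prog} {e : RExpr} {s : Store} {T T₁ T₂ : ℕ} {R R₁ R₂ : Store → Prop}

theorem mono (h : Run c s T₁ R₁) (hT : T₁ ≤ T₂) (hR : ∀ s', Frame c s s' → R₁ s' → R₂ s') :
    Run c s T₂ R₂ := by
  obtain ⟨t, s', h1, h2, h3⟩ := h
  exact ⟨t, s', h1, h2.trans hT, hR s' h1.frame h3⟩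

theorem skip (h : R s) : Run .skip s 1 R :=
  ⟨_, _, .skip s, le_rfl, h⟩

theorem assign {x : ℕ} (h : R (s.setReg x (e.eval s))) : Run (.assign x e) s (e.cost + 1) R :=
  ⟨_, _, .assign x e s, le_rfl, h⟩

theorem store {a : ℕ} {idx : RExpr} (h : R (s.setArr a (idx.eval s) (e.eval s))) :
    Run (.store a idx e) s (idx.cost + e.cost + 1) R :=
  ⟨_, _, .store a idx e s, le_rfl, h⟩

theorem seq (h₁ : Run c₁ s T₁ R₁) (h₂ : ∀ s', Frame c₁ s s' → R₁ s' → Run c₂ s' T₂ R) :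
    Run (.seq c₁ c₂) s (T₁ + T₂) R := by
  obtain ⟨t₁, s₁, h1, h2, h3⟩ := h₁
  obtain ⟨t₂, s₂, h4, h5, h6⟩ := h₂ s₁ h1.frame h3
  exact ⟨_, _, .seq h1 h4, Nat.add_le_add h2 h5, h6⟩

theorem assign_seq {x : ℕ} (h : Run c (s.setReg x (e.eval s)) T R) :
    Run (.seq (.assign x e) c) s (e.cost + 1 + T) R := by
  obtain ⟨t, s', h1, h2, h3⟩ := h
  exact ⟨_, _, .seq (.assign x e s) h1, Nat.add_le_add_left h2 _, h3⟩

theorem store_seq {a : ℕ} {idx : RExpr} (h : Run c (s.setArr a (idx.eval s) (e.eval s)) T R) :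
    Run (.seq (.store a idx e) c) s (idx.cost + e.cost + 1 + T) R := by
  obtain ⟨t, s', h1, h2, h3⟩ := h
  exact ⟨_, _, .seq (.store a idx e s) h1, Nat.add_le_add_left h2 _, h3⟩

theorem ite (h₁ : e.eval s ≠ 0 → Run c₁ s T R) (h₂ : e.eval s = 0 → Run c₂ s T R) :
    Run (.ite e c₁ c₂) s (e.cost + 1 + T) R := by
  by_cases he : e.eval s = 0
  · obtain ⟨t, s', h1, h2, h3⟩ := h₂ he
    exact ⟨_, _, .ite_false he h1, Nat.add_le_add_left h2 _, h3⟩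
  · obtain ⟨t, s', h1, h2, h3⟩ := h₁ he
    exact ⟨_, _, .ite_true he h1, Nat.add_le_add_left h2 _, h3⟩

/-- A test without alternative. -/
theorem ite_skip (h₁ : e.eval s ≠ 0 → Run c s T R) (h₂ : e.eval s = 0 → R s) :
    Run (.ite e c .skip) s (e.cost + 1 + (T + 1)) R :=
  ite (fun he => (h₁ he).mono (Nat.le_succ _) fun _ _ h => h)
    (fun he => (skip (h₂ he)).mono (Nat.le_add_left _ _) fun _ _ h => h)

/-- The index of `Inv` is a variant that must drop in every round, so it bounds the number of
rounds; the additional one pays for the final test. -/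
theorem loop {k : ℕ} (Inv : ℕ → Store → Prop) (h0 : Inv k s)
    (hstep : ∀ k s', Frame (.loop e c) s s' → Inv k s' → e.eval s' ≠ 0 →
      Run c s' T (fun s'' => ∃ k' < k, Inv k' s'')) :
    Run (.loop e c) s ((k + 1) * (T + e.cost + 1)) (fun s' => e.eval s' = 0 ∧ ∃ k', Inv k' s') := by
  have key : ∀ k s', Frame (.loop e c) s s' → Inv k s' → Run (.loop e c) s'
      ((k + 1) * (T + e.cost + 1)) (fun s' => e.eval s' = 0 ∧ ∃ k', Inv k' s') := by
    intro k
    induction k using Nat.strong_induction_on with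
    | _ k ih =>
    intro s' hF hI
    by_cases he : e.eval s' = 0
    · refine ⟨_, _, .loop_done he, ?_, he, k, hI⟩
      nlinarith
    · obtain ⟨t₁, s₁, h1, h2, k', hk', hI'⟩ := hstep k s' hF hI he
      have hF1 := h1.frame
      obtain ⟨t₂, s₂, h3, h4, h5⟩ := ih k' hk' s₁ ⟨fun x hx => by rw [hF1.reg x hx, hF.reg x hx],
        fun a ha => by rw [hF1.arr a ha, hF.arr a ha]⟩ hI'
      refine ⟨_, _, .loop_step he h1 h3, ?_, h5⟩
      have : (k' + 1) * (T + e.cost + 1) ≤ k * (T + e.cost + 1) := Nat.mul_le_mul_right _ hk'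
      rw [add_mul k 1, one_mul]
      omega
  exact key k s ⟨fun _ _ => rfl, fun _ _ => rfl⟩ h0

end Run

/-- The loop over the values of register `x` below the value of register `N`. -/
def Prog.forLoop (x N : ℕ) (c : Prog) : Prog :=
  .seq (.assign x (.const 0))
    (.loop (.lt (.reg x) (.reg N)) (.seq c (.assign x (.add (.reg x) (.const 1)))))

/-- The body writes neither the counter nor the bound, so the invariant may be indexed by the
counter. It is required after the increment, hence the `setReg`. -/
theorem Run.forLoop {x N : ℕ} {c : Prog} {s : Store} {T : ℕ} (Inv : ℕ → Store → Prop)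
    (hx : c.writesReg x = false) (hN : (c.writesReg N || N == x) = false)
    (h0 : Inv 0 (s.setReg x 0))
    (hstep : ∀ k < s.reg N, ∀ s', Frame (.forLoop x N c) s s' → s'.reg x = k → Inv k s' →
      Run c s' T (fun s'' => Inv (k + 1) (s''.setReg x (k + 1)))) :
    Run (.forLoop x N c) s (s.reg N * (T + 8) + (T + 10)) (Inv (s.reg N)) := by
  rw [Bool.or_eq_false_iff] at hN
  have hNx : N ≠ x := by simpa using hN.2
  have hFN : (Prog.forLoop x N c).writesReg N = false := by
    simp [Prog.forLoop, Prog.writesReg, hN.1, hNx]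
  have hs0 : (s.setReg x 0).reg N = s.reg N := by simp [hNx]
  -- Four steps pay for the increment; the variant is the number of values still to come.
  have := Run.assign_seq (x := x) (e := .const 0) (s := s) (Run.loop (T := T + 4)
    (e := .lt (.reg x) (.reg N)) (c := .seq c (.assign x (.add (.reg x) (.const 1))))
    (k := s.reg N) (s := s.setReg x 0)
    (fun k s' => s'.reg x ≤ s.reg N ∧ k = s.reg N - s'.reg x ∧ Inv (s'.reg x) s') (by simpa using h0)
    (by
      rintro k s' hF ⟨hle, hk, hI⟩ he
      have hFor : Frame (.forLoop x N c) s s' := by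
        refine ⟨fun y hy => ?_, fun a ha => ?_⟩
        · simp only [Prog.forLoop, Prog.writesReg, Bool.or_eq_false_iff, beq_eq_false_iff_ne] at hy
          rw [hF.reg y (by simp [Prog.writesReg, hy])]
          simp [hy.1]
        · simp only [Prog.forLoop, Prog.writesArr, Bool.false_or, Bool.or_false] at ha
          exact hF.arr a (by simp [Prog.writesArr, ha])
      have hlt : s'.reg x < s.reg N := by
        rw [← hFor.reg N hFN]
        simpa using he
      refine (Run.seq (hstep (s'.reg x) hlt s' hFor rfl hI) fun s'' hF' h'' => Run.assign (R :=
        fun s'' => ∃ k' < k, s''.reg x ≤ s.reg N ∧ k' = s.reg N - s''.reg x ∧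
          Inv (s''.reg x) s'') ?_).mono le_rfl fun _ _ h => h
      have hx' : s''.reg x = s'.reg x := hF'.reg x hx
      simp only [RExpr.eval_add, RExpr.eval_reg, RExpr.eval_const, hx', Store.setReg_reg, if_true]
      exact ⟨_, by omega, hlt, rfl, h''⟩))
  refine this.mono ?_ ?_
  · simp only [RExpr.cost]
    nlinarith
  · rintro s' hF ⟨he, k', hle, -, hI⟩
    have hN' : s'.reg N = s.reg N := hF.reg N hFN
    have : ¬ s'.reg x < s.reg N := by
      rw [← hN']
      simpa using he
    have hxN : s'.reg x = s.reg N := by omega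
    rwa [hxN] at hI

infixr:60 " ;; " => Prog.seq

/-! ### The Hungarian method as a program

Registers and arrays of the program, including those that prepare the costs. -/

notation "rN" => 0
notation "rM" => 1
notation "rK" => 2
notation "rR" => 3
notation "rR1" => 4
notation "rI" => 5
notation "rJ" => 6
notation "rFound" => 7
notation "rBest" => 8
notation "rBI" => 9
notation "rBJ" => 10
notation "rCol" => 11
notation "rNext" => 12
notation "rL" => 13

notation "aVal" => 0
notation "aPref" => 1
notation "aOut" => 2
notation "aMulN" => 3
notation "aMulK" => 4
notation "aTeam" => 5
notation "aRank" => 6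
notation "aPow" => 7
notation "aCost" => 8
notation "aU" => 9
notation "aV" => 10
notation "aMate" => 11
notation "aTree" => 12
notation "aWay" => 13
notation "aUsed" => 14

namespace Hungarian

open RExpr Prog

/-- The slack of the dual constraint of row `rI` and column `rJ`. -/
def slackExpr : RExpr :=
  sub (add (load aCost (add (load aMulK (reg rI)) (reg rJ))) (load aV (reg rJ))) (load aU (reg rI))

/-- Compares the slack of the edge from `rI` to `rJ` with the best one so far. -/
def tryBest : Prog :=
  ite (eq (load aTree (reg rJ)) (const 0))
    (ite (add (eq (reg rFound) (const 0)) (lt slackExpr (reg rBest)))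
      (assign rFound (const 1) ;; assign rBest slackExpr ;; assign rBI (reg rI) ;;
        assign rBJ (reg rJ)) skip) skip

/-- Compares the slacks of the edges from row `rI`, if it is in the tree. -/
def tryRow : Prog :=
  ite (load aTree (load aMate (reg rI))) (forLoop rJ rK tryBest) skip

/-- Finds the smallest slack of an edge that leaves the tree. -/
def findMin : Prog :=
  assign rFound (const 0) ;; forLoop rI rR1 tryRow

/-- Raises the dual variable of row `rI`, if it is in the tree. -/
def raiseRow : Prog :=
  ite (load aTree (load aMate (reg rI)))
    (store aU (reg rI) (add (load aU (reg rI)) (reg rBest))) skip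

/-- Raises the dual variable of column `rJ`, if it is in the tree. -/
def raiseCol : Prog :=
  ite (load aTree (reg rJ)) (store aV (reg rJ) (add (load aV (reg rJ)) (reg rBest))) skip

/-- Adds a column to the tree. -/
def grow : Prog :=
  findMin ;; forLoop rI rR1 raiseRow ;; forLoop rJ rK raiseCol ;;
    store aTree (reg rBJ) (const 1) ;; store aWay (reg rBJ) (reg rBI) ;; assign rCol (reg rBJ)

/-- Grows the tree until it contains an unused column. -/
def growLoop : Prog := loop (load aUsed (reg rCol)) grow

/-- Flips the path to the column that was reached last. -/
def flipLoop : Prog :=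
  loop (lt (reg rCol) (reg rK))
    (assign rNext (load aMate (load aWay (reg rCol))) ;;
      store aMate (load aWay (reg rCol)) (reg rCol) ;; assign rCol (reg rNext))

/-- Assigns the row `rR`. -/
def insert : Prog :=
  assign rR1 (add (reg rR) (const 1)) ;; store aMate (reg rR) (reg rK) ;;
    store aUsed (reg rK) (const 1) ;; forLoop rJ rK (store aTree (reg rJ) (const 0)) ;;
    store aTree (reg rK) (const 1) ;; assign rCol (reg rK) ;; growLoop ;;
    store aUsed (reg rCol) (const 1) ;; flipLoop

/-- Assigns all rows. -/
def solve : Prog := forLoop rR rM insert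

/-- The registers `rBest`, `rBI`, `rBJ` hold the minimum of `f` on the pairs in `S` and where it is
attained; `rFound` tells whether `S` is nonempty. -/
def IsBest (f : ℕ → ℕ → ℕ) (S : ℕ → ℕ → Prop) (s : Store) : Prop :=
  (s.reg rFound = 0 ∧ ∀ i j, ¬ S i j) ∨
    (s.reg rFound ≠ 0 ∧ S (s.reg rBI) (s.reg rBJ) ∧ s.reg rBest = f (s.reg rBI) (s.reg rBJ) ∧
      ∀ i j, S i j → s.reg rBest ≤ f i j)

theorem IsBest.congr {f : ℕ → ℕ → ℕ} {S S' : ℕ → ℕ → Prop} {s : Store} (h : IsBest f S s)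
    (hS : ∀ i j, S' i j ↔ S i j) : IsBest f S' s := by
  have : S' = S := by
    ext i j
    exact hS i j
  rwa [this]

/-- The slack computed from the memory. -/
def slack (s : Store) (i j : ℕ) : ℕ :=
  s.arr aCost (s.arr aMulK i + j) + s.arr aV j - s.arr aU i

@[simp] theorem eval_slackExpr (s : Store) :
    slackExpr.eval s = slack s (s.reg rI) (s.reg rJ) := by
  simp [slackExpr, slack]

theorem slack_congr {s s' : Store} (h : s'.arr = s.arr) : slack s' = slack s := by
  unfold slack
  rw [h]

theorem run_tryBest {s : Store} {S : ℕ → ℕ → Prop} (h : IsBest (slack s) S s) :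
    Run tryBest s 50 (IsBest (slack s) (fun i j => S i j ∨
      i = s.reg rI ∧ j = s.reg rJ ∧ s.arr aTree j = 0)) := by
  refine Run.mono (Run.ite_skip (fun he => Run.ite_skip (T := 19) (fun he' => ?_) fun he' => ?_)
    fun he => ?_)
    (T₂ := 50) (by simp [RExpr.cost, slackExpr]) fun _ _ h => h
  · refine Run.mono (Run.assign_seq <| Run.assign_seq <| Run.assign_seq <| Run.assign
      (R := IsBest (slack s) (fun i j => S i j ∨
      i = s.reg rI ∧ j = s.reg rJ ∧ s.arr aTree j = 0)) ?_) (by simp [RExpr.cost, slackExpr])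
        fun _ _ h => h
    simp only [eval_eq, eval_load, eval_reg, eval_const, ne_eq, ite_eq_right_iff, one_ne_zero,
      imp_false, not_not] at he
    refine Or.inr ⟨by simp, ?_, by simp [slack], ?_⟩
    · simp [he]
    · intro i j hij
      have hb : (slack s) (s.reg rI) (s.reg rJ) ≤ (slack s) i j := by
        rcases hij with hij | ⟨rfl, rfl, -⟩
        · rcases h with ⟨-, h⟩ | ⟨h1, -, h2, h3⟩
          · exact absurd hij (h i j)
          · have hlt : (slack s) (s.reg rI) (s.reg rJ) < s.reg rBest := by
              simpa [h1] using he'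
            exact hlt.le.trans (h3 i j hij)
        · exact le_rfl
      simpa [slack] using hb
  · simp only [eval_add, eval_eq, eval_lt, eval_reg, eval_const, eval_slackExpr,
      Nat.add_eq_zero_iff, ite_eq_right_iff, one_ne_zero, imp_false, not_lt] at he'
    rcases h with ⟨h, -⟩ | ⟨h1, h2, h3, h4⟩
    · exact absurd h he'.1
    · refine Or.inr ⟨h1, Or.inl h2, h3, ?_⟩
      rintro i j (hij | ⟨rfl, rfl, -⟩)
      · exact h4 i j hij
      · exact he'.2
  · refine h.congr fun i j => or_iff_left ?_
    rintro ⟨-, rfl, ht⟩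
    simp [ht] at he

/-- The row `i` and the column `j` are the ends of an edge that leaves the tree. -/
def Leaves (s : Store) (i j : ℕ) : Prop :=
  s.arr aTree (s.arr aMate i) ≠ 0 ∧ s.arr aTree j = 0

/-- The pairs are scanned row by row; the inner invariant covers the pairs that precede `(k, l)`
lexicographically. -/
theorem run_tryRow {s : Store} {k : ℕ} (hk : s.reg rI = k)
    (h : IsBest (slack s) (fun i j => i < k ∧ j < s.reg rK ∧ Leaves s i j) s) :
    Run tryRow s (s.reg rK * 58 + 70)
      (IsBest (slack s) (fun i j => i < k + 1 ∧ j < s.reg rK ∧ Leaves s i j)) := by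
  refine Run.mono (Run.ite_skip (fun he => (Run.forLoop (T := 50) (fun l s' => IsBest (slack s)
    (fun i j => (i < k ∧ j < s.reg rK ∨ i = k ∧ j < l) ∧ Leaves s i j) s') rfl rfl ?_ ?_).mono
      le_rfl ?_) fun he => ?_) (by simp [RExpr.cost]; omega) fun _ _ h => h
  · refine IsBest.congr (S := fun i j => i < k ∧ j < s.reg rK ∧ Leaves s i j) h ?_
    simp [and_assoc]
  · intro l hl s' hF hj hI
    have hA : s'.arr = s.arr := funext fun a => hF.arr a rfl
    have hi : s'.reg rI = k := (hF.reg rI rfl).trans hk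
    have hI' := slack_congr hA ▸ hI
    refine (run_tryBest hI').mono le_rfl fun s'' hF' h'' => ?_
    refine IsBest.congr (S := _) (show IsBest (slack s) _ s'' from slack_congr hA ▸ h'') ?_
    intro i j
    have he' : s.arr aTree (s.arr aMate k) ≠ 0 := by simpa [hk] using he
    simp only [hi, hj, hA, Leaves, Nat.lt_succ_iff_lt_or_eq]
    constructor
    · rintro ⟨h1 | ⟨rfl, h1 | rfl⟩, h2⟩
      · exact Or.inl ⟨Or.inl h1, h2⟩
      · exact Or.inl ⟨Or.inr ⟨rfl, h1⟩, h2⟩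
      · exact Or.inr ⟨rfl, rfl, h2.2⟩
    · rintro (⟨h1 | ⟨rfl, h1⟩, h2⟩ | ⟨rfl, rfl, h2⟩)
      · exact ⟨Or.inl h1, h2⟩
      · exact ⟨Or.inr ⟨rfl, Or.inl h1⟩, h2⟩
      · exact ⟨Or.inr ⟨rfl, Or.inr rfl⟩, he', h2⟩
  · intro s' hF h'
    refine IsBest.congr h' fun i j => ?_
    rw [Nat.lt_succ_iff_lt_or_eq, ← and_assoc, or_and_right]
  · refine h.congr fun i j => ?_
    have he' : s.arr aTree (s.arr aMate k) = 0 := by simpa [hk] using he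
    rw [Nat.lt_succ_iff_lt_or_eq, or_and_right]
    refine or_iff_left ?_
    rintro ⟨rfl, -, h1, -⟩
    exact h1 he'

theorem run_findMin (s : Store) :
    Run findMin s (s.reg rR1 * (s.reg rK * 58 + 78) + (s.reg rK * 58 + 82))
      (IsBest (slack s) (fun i j => i < s.reg rR1 ∧ j < s.reg rK ∧ Leaves s i j)) := by
  refine Run.mono (Run.assign_seq (Run.forLoop (T := s.reg rK * 58 + 70) (fun k s' =>
    IsBest (slack s) (fun i j => i < k ∧ j < s.reg rK ∧ Leaves s i j) s') rfl rfl ?_ ?_))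
    (by norm_num [RExpr.cost, add_assoc]; omega) ?_
  · exact Or.inl ⟨by simp, by simp⟩
  · intro k hk s' hF hi hI
    have hA : s'.arr = s.arr := funext fun a => hF.arr a rfl
    have hK : s'.reg rK = s.reg rK := hF.reg rK rfl
    have hL : Leaves s' = Leaves s := by
      unfold Leaves
      rw [hA]
    have := run_tryRow (s := s') (k := k) hi (by
      rw [slack_congr hA, hL, hK]
      exact hI)
    rw [slack_congr hA, hL, hK] at this
    exact this.mono le_rfl fun s'' _ h => h
  · intro s' _ h
    exact h.congr fun i j => by simp

theorem run_raiseRows (s : Store) :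
    Run (forLoop rI rR1 raiseRow) s (s.reg rR1 * 30 + 32) (fun s' => ∀ i, s'.arr aU i =
      s.arr aU i + if i < s.reg rR1 ∧ s.arr aTree (s.arr aMate i) ≠ 0 then s.reg rBest else 0) := by
  refine Run.mono (Run.forLoop (T := 22) (fun k s' => ∀ i, s'.arr aU i = s.arr aU i +
    if i < k ∧ s.arr aTree (s.arr aMate i) ≠ 0 then s.reg rBest else 0) rfl rfl ?_ ?_) le_rfl
    fun _ _ h => h
  · simp
  · intro k hk s' hF hi hI
    have hT : s'.arr aTree = s.arr aTree := hF.arr aTree rfl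
    have hM : s'.arr aMate = s.arr aMate := hF.arr aMate rfl
    have hB : s'.reg rBest = s.reg rBest := hF.reg rBest rfl
    refine Run.mono (Run.ite_skip (fun he => Run.store (R := fun s'' => ∀ i, s''.arr aU i =
      s.arr aU i + if i < k + 1 ∧ s.arr aTree (s.arr aMate i) ≠ 0 then s.reg rBest else 0) ?_)
      fun he => ?_) (by simp [RExpr.cost]) fun _ _ h => h
    · intro i
      have he' : s.arr aTree (s.arr aMate k) ≠ 0 := by simpa [hi, hT, hM] using he
      simp only [Store.setArr_arr, if_true, eval_reg, eval_add, eval_load, hi, hB]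
      by_cases e : i = k
      · subst e
        simp [hI, he']
      · rw [Function.update_of_ne e, hI i]
        simp [Nat.le_iff_lt_or_eq, e]
    · intro i
      have he' : s.arr aTree (s.arr aMate k) = 0 := by simpa [hi, hT, hM] using he
      rw [hI i]
      by_cases e : i = k
      · subst e
        simp [he']
      · simp [Nat.le_iff_lt_or_eq, e]

theorem run_raiseCols (s : Store) :
    Run (forLoop rJ rK raiseCol) s (s.reg rK * 30 + 32) (fun s' => ∀ j, s'.arr aV j =
      s.arr aV j + if j < s.reg rK ∧ s.arr aTree j ≠ 0 then s.reg rBest else 0) := by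
  refine Run.mono (Run.forLoop (T := 22) (fun k s' => ∀ j, s'.arr aV j = s.arr aV j +
    if j < k ∧ s.arr aTree j ≠ 0 then s.reg rBest else 0) rfl rfl ?_ ?_) le_rfl
    fun _ _ h => h
  · simp
  · intro k hk s' hF hi hI
    have hT : s'.arr aTree = s.arr aTree := hF.arr aTree rfl
    have hB : s'.reg rBest = s.reg rBest := hF.reg rBest rfl
    refine Run.mono (Run.ite_skip (fun he => Run.store (R := fun s'' => ∀ j, s''.arr aV j =
      s.arr aV j + if j < k + 1 ∧ s.arr aTree j ≠ 0 then s.reg rBest else 0) ?_)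
      fun he => ?_) (by simp [RExpr.cost]) fun _ _ h => h
    · intro j
      have he' : s.arr aTree k ≠ 0 := by simpa [hi, hT] using he
      simp only [Store.setArr_arr, if_true, eval_reg, eval_add, eval_load, hi, hB]
      by_cases e : j = k
      · subst e
        simp [hI, he']
      · rw [Function.update_of_ne e, hI j]
        simp [Nat.le_iff_lt_or_eq, e]
    · intro j
      have he' : s.arr aTree k = 0 := by simpa [hi, hT] using he
      rw [hI j]
      by_cases e : j = k
      · subst e
        simp [he']
      · simp [Nat.le_iff_lt_or_eq, e]

/-- The memory holds the data of the relation `Tree`. -/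
def TreeAt (C : ℕ → ℕ → ℕ) (m K r : ℕ) (ord : ℕ → ℕ) (s : Store) : Prop :=
  Tree C m K r (s.arr aU) (s.arr aV) (s.arr aMate) (s.arr aUsed) (s.arr aTree) (s.arr aWay) ord
    (s.reg rCol)

/-- One pass of the program realizes `Tree.step`. The function `ord` is not stored in memory and
exists only in the proof. -/
theorem run_grow {C : ℕ → ℕ → ℕ} {m K r : ℕ} {ord : ℕ → ℕ} {s : Store}
    (hC : ∀ i j, s.arr aCost (s.arr aMulK i + j) = C i j) (hK : s.reg rK = K)
    (hR1 : s.reg rR1 = r + 1) (hr : r < m) (hm : m ≤ K) (h : TreeAt C m K r ord s)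
    (hu : s.arr aUsed (s.reg rCol) ≠ 0) :
    Run grow s ((r + 1) * (K * 58 + 108) + (K * 88 + 170)) (fun s' =>
      ∃ ord', TreeAt C m K r ord' s' ∧
        numOutside K (s'.arr aTree) + 1 = numOutside K (s.arr aTree) ∧
        ord' (s'.reg rCol) = ord (s.reg rCol) + 1) := by
  refine Run.mono (Run.seq (run_findMin s) fun s₁ hF₁ h₁ =>
    Run.seq ((run_raiseRows s₁).mono (T₂ := (r + 1) * 30 + 32) ?_ fun _ _ h => h)
      fun s₂ hF₂ h₂ =>
    Run.seq ((run_raiseCols s₂).mono (T₂ := K * 30 + 32) ?_ fun _ _ h => h) fun s₃ hF₃ h₃ =>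
    Run.store_seq <| Run.store_seq <| Run.assign
    (R := (fun s' => ∃ ord', TreeAt C m K r ord' s' ∧
        numOutside K (s'.arr aTree) + 1 = numOutside K (s.arr aTree) ∧
        ord' (s'.reg rCol) = ord (s.reg rCol) + 1)) ?_) ?_ fun _ _ h => h
  · rw [hF₁.reg rR1 rfl, hR1]
  · rw [hF₂.reg rK rfl, hF₁.reg rK rfl, hK]
  · have hA : s₁.arr = s.arr := funext fun a => hF₁.arr a rfl
    have hT : s₃.arr aTree = s.arr aTree := by rw [hF₃.arr aTree rfl, hF₂.arr aTree rfl, hA]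
    have hT₂ : s₂.arr aTree = s.arr aTree := by rw [hF₂.arr aTree rfl, hA]
    have hM : s₃.arr aMate = s.arr aMate := by rw [hF₃.arr aMate rfl, hF₂.arr aMate rfl, hA]
    have hUs : s₃.arr aUsed = s.arr aUsed := by rw [hF₃.arr aUsed rfl, hF₂.arr aUsed rfl, hA]
    have hW : s₃.arr aWay = s.arr aWay := by rw [hF₃.arr aWay rfl, hF₂.arr aWay rfl, hA]
    have hV₂ : s₂.arr aV = s.arr aV := by rw [hF₂.arr aV rfl, hA]
    have hBI : s₃.reg rBI = s₁.reg rBI := by rw [hF₃.reg rBI rfl, hF₂.reg rBI rfl]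
    have hBJ : s₃.reg rBJ = s₁.reg rBJ := by rw [hF₃.reg rBJ rfl, hF₂.reg rBJ rfl]
    have hB : s₂.reg rBest = s₁.reg rBest := hF₂.reg rBest rfl
    have hK₂ : s₂.reg rK = K := by rw [hF₂.reg rK rfl, hF₁.reg rK rfl, hK]
    have hR1' : s₁.reg rR1 = r + 1 := by rw [hF₁.reg rR1 rfl, hR1]
    have hone : ∀ j ≤ K, s.arr aTree j ≠ 0 ↔ s.arr aTree j = 1 := fun j hj => by
      have := h.tree_le j hj
      omega
    have hslack : ∀ i j, slack s i j = C i j + s.arr aV j - s.arr aU i := fun i j => by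
      rw [slack, hC]
    obtain ⟨j, hj, hjt⟩ := h.exists_outside (hr.trans_le hm) hu
    -- The search cannot fail: row `r` is in the tree and column `j` is not.
    obtain ⟨-, hno⟩ | ⟨-, ⟨h4, h5, h6, h7⟩, h8, h9⟩ := h₁
    · refine absurd ?_ (hno r j)
      refine ⟨by omega, by omega, ?_, hjt⟩
      rw [h.mate_row, h.tree_K]
      exact one_ne_zero
    rw [hR1, Nat.lt_succ_iff] at h4
    rw [hK] at h5
    have h6' := (hone _ (h.mate_le h4)).1 h6
    -- Feasibility makes the truncated subtraction in `slack` exact.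
    have hfeas := h.feas (s₁.reg rBI) (by omega) (s₁.reg rBJ) h5
    have hstep := h.step hu (bi := s₁.reg rBI) (bj := s₁.reg rBJ) (δ := s₁.reg rBest) h4 h6' h5 h7
      (by rw [h8, hslack]; omega)
      (fun i hi ht j hj hjt => by
        have h10 := h9 i j ⟨by omega, by omega, (hone _ (h.mate_le hi)).2 ht, hjt⟩
        have h11 := h.feas i (by omega) j hj
        rw [hslack] at h10
        omega)
      (u' := s₃.arr aU) (v' := s₃.arr aV)
      (fun i => by
        rw [hF₃.arr aU rfl, h₂ i, hR1', hA]
        congr 1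
        refine if_congr ?_ rfl rfl
        rw [Nat.lt_succ_iff]
        exact and_congr_right fun hi => hone _ (h.mate_le hi))
      (fun j => by
        rw [h₃ j, hV₂, hT₂, hB, hK₂]
        congr 1
        refine if_congr ?_ rfl rfl
        exact and_congr_right fun hj => hone _ hj.le)
    refine ⟨Function.update ord (s₁.reg rBJ) (ord (s.reg rCol) + 1), ?_, ?_, ?_⟩
    · unfold TreeAt
      simpa [hT, hBJ, hBI, hM, hUs, hW] using hstep
    · simp only [Store.setReg_arr, Store.setArr_arr, if_true, eval_reg, hT, hBJ, eval_const]
      exact numOutside_update h5 h7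
    · simp only [Store.setReg_reg, if_true, eval_reg, Store.setArr_reg, hBJ]
      exact Function.update_self ..
  · rw [hR1, hK]
    simp only [RExpr.cost]
    nlinarith

end Hungarian

namespace Hungarian

open RExpr Prog

/-- The number of columns outside the tree is the variant. It loses one whenever `ord` of the
current column gains one, so `ord` stays at most `K`, which later bounds the flips. -/
theorem run_growLoop {C : ℕ → ℕ → ℕ} {m K r : ℕ} {ord : ℕ → ℕ} {s : Store}
    (hC : ∀ i j, s.arr aCost (s.arr aMulK i + j) = C i j) (hK : s.reg rK = K)
    (hR1 : s.reg rR1 = r + 1) (hr : r < m) (hm : m ≤ K) (h : TreeAt C m K r ord s)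
    (hord : ord (s.reg rCol) = 0) :
    Run growLoop s ((K + 1) * ((r + 1) * (K * 58 + 108) + (K * 88 + 170) + 3)) (fun s' =>
      s'.arr aUsed (s'.reg rCol) = 0 ∧ ∃ ord', TreeAt C m K r ord' s' ∧ ord' (s'.reg rCol) ≤ K) := by
  refine Run.mono (Run.loop (k := numOutside K (s.arr aTree))
    (T := (r + 1) * (K * 58 + 108) + (K * 88 + 170)) (fun k s' => ∃ ord', TreeAt C m K r ord' s' ∧
      k = numOutside K (s'.arr aTree) ∧ ord' (s'.reg rCol) + k ≤ K) ?_ ?_) ?_ ?_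
  · exact ⟨ord, h, rfl, by rw [hord, zero_add]; exact numOutside_le _ _⟩
  · rintro k s' hF ⟨ord', hT, rfl, hle⟩ he
    refine (run_grow (s := s') (C := C) (m := m) (K := K) (r := r) (ord := ord') ?_ ?_ ?_ hr hm hT
      (by simpa using he)).mono le_rfl ?_
    · intro i j
      rw [hF.arr aCost rfl, hF.arr aMulK rfl, hC]
    · rw [hF.reg rK rfl, hK]
    · rw [hF.reg rR1 rfl, hR1]
    · rintro s'' - ⟨ord'', h1, h2, h3⟩
      exact ⟨_, by omega, ord'', h1, rfl, by omega⟩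
  · have := numOutside_le K (s.arr aTree)
    simp only [RExpr.cost]
    gcongr
  · rintro s' - ⟨he, k, ord', h1, h2, h3⟩
    exact ⟨by simpa using he, ord', h1, by omega⟩

/-- The memory holds the data of the relation `Flip`. -/
def FlipAt (C : ℕ → ℕ → ℕ) (m K r : ℕ) (ord : ℕ → ℕ) (s : Store) : Prop :=
  Flip C m K r (s.arr aU) (s.arr aV) (s.arr aMate) (s.arr aUsed) (s.arr aTree) (s.arr aWay) ord
    (s.reg rCol)

/-- The memory holds the data of the relation `Dual`. -/
def DualAt (C : ℕ → ℕ → ℕ) (m K r : ℕ) (s : Store) : Prop :=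
  Dual C m K r (s.arr aU) (s.arr aV) (s.arr aMate) (s.arr aUsed)

/-- The variant is `ord` of the current column, and the loop stops at the virtual column `K`. -/
theorem run_flipLoop {C : ℕ → ℕ → ℕ} {m K r : ℕ} {ord : ℕ → ℕ} {s : Store} (hK : s.reg rK = K)
    (h : FlipAt C m K r ord s) (hord : ord (s.reg rCol) ≤ K) :
    Run flipLoop s ((K + 1) * 20) (DualAt C m K (r + 1)) := by
  refine Run.mono (Run.loop (k := ord (s.reg rCol)) (T := 16) (fun k s' => FlipAt C m K r ord s' ∧
    k = ord (s'.reg rCol)) ⟨h, rfl⟩ ?_) ?_ ?_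
  · rintro k s' hF ⟨hT, rfl⟩ he
    have hlt : s'.reg rCol < K := by
      have : s'.reg rK = K := (hF.reg rK rfl).trans hK
      simpa [this] using he
    refine Run.mono (Run.assign_seq <| Run.store_seq <| Run.assign (R := fun s'' =>
      ∃ k' < ord (s'.reg rCol), FlipAt C m K r ord s'' ∧ k' = ord (s''.reg rCol)) ?_)
      (by simp [RExpr.cost]) fun _ _ h => h
    refine ⟨_, ?_, ?_, rfl⟩
    · simpa using hT.ord_mate_lt hlt
    · have := hT.step hlt
      unfold FlipAt
      simpa using this
  · simp only [RExpr.cost]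
    omega
  · rintro s' hF ⟨he, k, hT, -⟩
    refine hT.dual (le_antisymm hT.j₀_le ?_)
    have : s'.reg rK = K := (hF.reg rK rfl).trans hK
    simpa [this] using he

/-- A bound for the running time of `insert`. -/
def insertTime (m K : ℕ) : ℕ :=
  (K + 1) * ((m + 1) * (K * 58 + 108) + (K * 88 + 170) + 3) + (K + 1) * 40 + 50

theorem run_clearTree (s : Store) :
    Run (forLoop rJ rK (store aTree (reg rJ) (const 0))) s (s.reg rK * 11 + 13)
      (fun s' => ∀ j < s.reg rK, s'.arr aTree j = 0) := by
  refine (Run.forLoop (T := 3) (fun k s' => ∀ j < k, s'.arr aTree j = 0) rfl rfl (by simp) ?_).mono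
    le_rfl fun _ _ h => h
  intro k _ s' hF hj hI
  refine Run.mono (Run.store (R := fun s'' => ∀ j < k + 1, s''.arr aTree j = 0) fun j hj' => ?_)
    (by simp [RExpr.cost]) fun _ _ h => h
  simp only [Store.setArr_arr, if_true, eval_reg, eval_const, hj]
  rcases Nat.lt_succ_iff_lt_or_eq.1 hj' with h1 | rfl
  · rw [Function.update_of_ne h1.ne]
    exact hI j h1
  · simp

theorem run_insert {C : ℕ → ℕ → ℕ} {m K r : ℕ} {s : Store}
    (hC : ∀ i j, s.arr aCost (s.arr aMulK i + j) = C i j) (hK : s.reg rK = K)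
    (hR : s.reg rR = r) (hr : r < m) (hm : m ≤ K) (h : DualAt C m K r s) :
    Run insert s (insertTime m K) (DualAt C m K (r + 1)) := by
  refine Run.mono (Run.assign_seq <| Run.store_seq <| Run.store_seq <|
    Run.seq ((run_clearTree _).mono (T₂ := K * 11 + 13) ?_ fun _ _ h => h) fun s₁ hF₁ h₁ =>
    Run.store_seq <| Run.assign_seq <| Run.seq
    (run_growLoop (C := C) (m := m) (K := K) (r := r) (ord := fun _ => 0) ?_ ?_ ?_ hr hm ?_ rfl)
      fun s₂ hF₂ ⟨h₂, ord, h₃, h₄⟩ => Run.store_seq <|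
    run_flipLoop (C := C) (m := m) (K := K) (r := r) (ord := ord) ?_ ?_ ?_) ?_ fun _ _ h => h
  · simp [hK]
  · intro i j
    have e1 := hF₁.arr aCost rfl
    have e2 := hF₁.arr aMulK rfl
    simp at e1 e2
    simp [e1, e2, hC]
  · have e1 := hF₁.reg rK rfl
    simp at e1
    simp [e1, hK]
  · have e1 := hF₁.reg rR1 rfl
    simp at e1
    simp [e1, hR]
  · have e1 := hF₁.reg rK rfl
    have e2 := hF₁.arr aU rfl
    have e3 := hF₁.arr aV rfl
    have e4 := hF₁.arr aMate rfl
    have e5 := hF₁.arr aUsed rfl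
    simp [hK, hR] at e1 e2 e3 e4 e5 h₁
    have := h.toTree (tree := Function.update (s₁.arr aTree) K 1)
      (fun j hj => by rw [Function.update_of_ne hj.ne, h₁ j hj]) (by simp) (s₁.arr aWay)
    unfold TreeAt
    simpa [e1, e2, e3, e4, e5] using this
  · have e1 := hF₁.reg rK rfl
    have e2 := hF₂.reg rK rfl
    simp at e1 e2
    simp [e1, e2, hK]
  · have := h₃.flip h₂
    unfold FlipAt
    simpa using this
  · simpa using h₄
  · have : (K + 1) * ((r + 1) * (K * 58 + 108) + (K * 88 + 170) + 3) ≤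
        (K + 1) * ((m + 1) * (K * 58 + 108) + (K * 88 + 170) + 3) := by gcongr
    simp only [RExpr.cost, insertTime]
    omega

theorem run_solve {C : ℕ → ℕ → ℕ} {m K : ℕ} {s : Store}
    (hC : ∀ i j, s.arr aCost (s.arr aMulK i + j) = C i j) (hM : s.reg rM = m) (hK : s.reg rK = K)
    (hm : m ≤ K) (hU : ∀ i, s.arr aU i = 0) (hV : ∀ i, s.arr aV i = 0)
    (hUsed : ∀ i, s.arr aUsed i = 0) :
    Run solve s (m * (insertTime m K + 8) + (insertTime m K + 10)) (DualAt C m K m) := by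
  refine (Run.forLoop (T := insertTime m K) (DualAt C m K) rfl rfl
    (Dual.init C m K _ hU hV hUsed) ?_).mono (by rw [hM]) (fun s' _ h => by rwa [hM] at h)
  intro k hk s' hF hR hI
  rw [hM] at hk
  refine (run_insert (fun i j => ?_) ((hF.reg rK rfl).trans hK) hR hk hm hI).mono le_rfl
    fun _ _ h => h
  rw [hF.arr aCost rfl, hF.arr aMulK rfl, hC]

end Hungarian

/-! ### Preparation of the costs -/

namespace Preparation

open RExpr Prog

/-- Computes the number `n + m * n` of positions. -/
def slots : Prog :=
  assign rK (reg rN) ;; forLoop rI rM (assign rK (add (reg rK) (reg rN)))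

/-- Tabulates the multiples of the number in register `x`. -/
def table (a x : ℕ) : Prog :=
  forLoop rI rK (store a (add (reg rI) (const 1)) (add (load a (reg rI)) (reg x)))

/-- Tabulates the teams of the positions. -/
def teams : Prog :=
  assign rJ (const 0) ;; forLoop rI rK (store aTeam (reg rI) (reg rJ) ;;
    assign rJ (add (reg rJ) (const 1)) ;; ite (eq (reg rJ) (reg rN)) (assign rJ (const 0)) skip)

/-- Tabulates the numbers `(m * n + 1) * 2 ^ k`. -/
def powers : Prog :=
  store aPow (const 0) (add (load aMulN (reg rM)) (const 1)) ;;
    forLoop rI rK (store aPow (add (reg rI) (const 1))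
      (add (load aPow (reg rI)) (load aPow (reg rI))))

/-- Tabulates the numbers of teams that are strictly better than a given one. -/
def ranks : Prog :=
  assign rL (load aMulN (reg rM)) ;; forLoop rI rL (forLoop rJ rN (store aRank (reg rI)
    (add (load aRank (reg rI))
      (eq (load aPref (add (load aMulN (reg rI)) (reg rJ))) (const 0)))))

/-- The position in the tables of row `rI` and the team of column `rJ`. -/
def cellExpr : RExpr := add (load aMulN (reg rI)) (load aTeam (reg rJ))

/-- The cost of the edge from row `rI` to column `rJ`, but for the value of the player. -/
def baseExpr : RExpr := add (load aRank cellExpr) (load aPow (reg rK))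

/-- Stores the cost of the edge from row `rI` to column `rJ`. -/
def costEntry : Prog :=
  ite (load aVal cellExpr)
    (store aCost (add (load aMulK (reg rI)) (reg rJ))
      (sub baseExpr (load aPow (sub (reg rK) (add (reg rJ) (const 1))))))
    (store aCost (add (load aMulK (reg rI)) (reg rJ)) baseExpr)

/-- Tabulates the costs. -/
def costs : Prog := forLoop rI rM (forLoop rJ rK costEntry)

/-- Reads off the teams of the players. -/
def output : Prog := forLoop rI rM (store aOut (reg rI) (load aTeam (load aMate (reg rI))))

/-- The whole algorithm. -/
def algorithm : Prog :=
  slots ;; table aMulN rN ;; table aMulK rK ;; teams ;; powers ;; ranks ;; costs ;;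
    Hungarian.solve ;; output

/-! ### Correctness and step bounds of the preparation. -/

theorem run_slots (s : Store) :
    Run slots s (s.reg rM * 12 + 16) (fun s' => s'.reg rK = s.reg rN + s.reg rM * s.reg rN) := by
  refine Run.mono (Run.assign_seq <| Run.forLoop (T := 4) (fun k s' =>
    s'.reg rK = s.reg rN + k * s.reg rN) rfl rfl (by simp) ?_) (by simp [RExpr.cost]; omega)
    fun _ _ h => h
  intro k _ s' hF hi hI
  have hN : s'.reg rN = s.reg rN := hF.reg rN rfl
  refine Run.mono (Run.assign (R := fun s'' => (s''.setReg rI (k + 1)).reg rK =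
    s.reg rN + (k + 1) * s.reg rN) ?_) (by simp [RExpr.cost]) fun _ _ h => h
  simp [hI, hN]
  ring

theorem run_table {a x : ℕ} (hx : x ≠ rI) {s : Store} (h0 : s.arr a 0 = 0) :
    Run (table a x) s (s.reg rK * 16 + 18) (fun s' => ∀ i ≤ s.reg rK,
      s'.arr a i = i * s.reg x) := by
  refine Run.mono (Run.forLoop (T := 8) (fun k s' => ∀ i ≤ k, s'.arr a i = i * s.reg x)
    rfl rfl (by simpa using h0) ?_) le_rfl fun _ _ h => h
  intro k _ s' hF hi hI
  have hX : s'.reg x = s.reg x := hF.reg x (by simp [forLoop, Prog.writesReg, hx])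
  refine Run.mono (Run.store (R := fun s'' => ∀ i ≤ k + 1, s''.arr a i = i * s.reg x) ?_)
    (by simp [RExpr.cost]) fun _ _ h => h
  intro i hik
  simp only [Store.setArr_arr, if_true, eval_add, eval_reg, eval_const, eval_load, hi, hX]
  rcases hik.lt_or_eq with h1 | rfl
  · rw [Function.update_of_ne h1.ne]
    exact hI i (Nat.lt_succ_iff.1 h1)
  · rw [Function.update_self, hI k le_rfl, add_mul, one_mul]

/-- Residues are obtained by counting and resetting the counter at `n`. -/
theorem run_teams {s : Store} (hn : 0 < s.reg rN) :
    Run teams s (s.reg rK * 30 + 40) (fun s' => ∀ i < s.reg rK,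
      s'.arr aTeam i = i % s.reg rN) := by
  refine Run.mono (Run.assign_seq <| Run.forLoop (T := 22) (fun k s' =>
    (∀ i < k, s'.arr aTeam i = i % s.reg rN) ∧ s'.reg rJ = k % s.reg rN)
    rfl rfl (by simp) ?_) (by simp [RExpr.cost]; omega) fun _ _ h => h.1
  intro k _ s' hF hi ⟨hI, hJ⟩
  have hN : s'.reg rN = s.reg rN := hF.reg rN rfl
  have hk := Nat.mod_lt k hn
  have hmod : (k + 1) % s.reg rN = if k % s.reg rN + 1 = s.reg rN then 0
      else k % s.reg rN + 1 := by
    rw [← Nat.mod_add_mod]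
    split_ifs with h
    · rw [h, Nat.mod_self]
    · exact Nat.mod_eq_of_lt (by omega)
  have hT : ∀ i < k + 1, Function.update (s'.arr aTeam) k (k % s.reg rN) i = i % s.reg rN := by
    intro i hik
    rcases Nat.lt_succ_iff_lt_or_eq.1 hik with h1 | rfl
    · rw [Function.update_of_ne h1.ne]
      exact hI i h1
    · simp
  refine Run.mono (Run.store_seq <| Run.assign_seq <| Run.ite_skip (T := 2) (fun he =>
    Run.assign (R := fun s'' => (∀ i < k + 1, s''.arr aTeam i = i % s.reg rN) ∧
      (s''.setReg rI (k + 1)).reg rJ = (k + 1) % s.reg rN) ?_) fun he => ?_)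
    (by simp [RExpr.cost]) fun _ _ h => h
  · refine ⟨by simpa [hi, hJ] using hT, ?_⟩
    have he' : k % s.reg rN + 1 = s.reg rN := by simpa [hi, hJ, hN] using he
    simp [hmod, he']
  · refine ⟨by simpa [hi, hJ] using hT, ?_⟩
    have he' : ¬ k % s.reg rN + 1 = s.reg rN := by simpa [hi, hJ, hN] using he
    simp [hmod, he', hJ]

theorem run_powers (s : Store) :
    Run powers s (s.reg rK * 17 + 30) (fun s' => ∀ i ≤ s.reg rK,
      s'.arr aPow i = (s.arr aMulN (s.reg rM) + 1) * 2 ^ i) := by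
  refine Run.mono (Run.store_seq <| Run.forLoop (T := 9) (fun k s' =>
    ∀ i ≤ k, s'.arr aPow i = (s.arr aMulN (s.reg rM) + 1) * 2 ^ i)
    rfl rfl (by simp) ?_) (by simp [RExpr.cost]; omega) fun _ _ h => by simpa using h
  intro k _ s' hF hi hI
  refine Run.mono (Run.store (R := fun s'' => ∀ i ≤ k + 1,
    s''.arr aPow i = (s.arr aMulN (s.reg rM) + 1) * 2 ^ i) ?_)
    (by simp [RExpr.cost]) fun _ _ h => h
  intro i hik
  simp only [Store.setArr_arr, if_true, eval_add, eval_reg, eval_const, eval_load, hi]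
  rcases hik.lt_or_eq with h1 | rfl
  · rw [Function.update_of_ne h1.ne]
    exact hI i (Nat.lt_succ_iff.1 h1)
  · rw [Function.update_self, hI k le_rfl]
    ring

/-- The number of zeros among the first `l` entries of row `y` of the table of preferences. -/
def countZeros (s : Store) (n y l : ℕ) : ℕ :=
  ∑ j ∈ Finset.range l, if s.arr aPref (y * n + j) = 0 then 1 else 0

theorem run_ranks {s : Store} {n mn : ℕ} (hn : s.reg rN = n) (hmn : s.arr aMulN (s.reg rM) = mn)
    (hmul : ∀ y < mn, s.arr aMulN y = y * n) (h0 : ∀ y, s.arr aRank y = 0) :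
    Run ranks s (mn * (n * 22 + 32) + (n * 22 + 40)) (fun s' => ∀ y < mn,
      s'.arr aRank y = countZeros s n y n) := by
  refine Run.mono (Run.assign_seq <| Run.forLoop (T := n * 22 + 24) (fun k s' =>
    ∀ y, s'.arr aRank y = countZeros s n y (if y < k then n else 0))
    rfl rfl (by simp [h0, countZeros]) ?_)
    (by norm_num [RExpr.cost, hmn, add_assoc]; omega) fun s' _ h y hy => ?_
  · intro k hk s₁ hF₁ hi₁ hI₁
    simp only [eval_load, eval_reg, Store.setReg_reg, if_true, hmn] at hk
    have hN₁ : s₁.reg rN = n := (hF₁.reg rN rfl).trans hn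
    -- Cells before `k` are finished, cell `k` has seen `l` teams, and later cells are still zero.
    refine Run.mono (Run.forLoop (T := 14) (fun l s' =>
      ∀ y, s'.arr aRank y = countZeros s n y (if y < k then n else if y = k then l else 0))
      rfl rfl (by simpa using hI₁) ?_)
      (by rw [hN₁]) fun s' _ h y => ?_
    · intro l hl s₂ hF₂ hj₂ hI₂
      have hi₂ : s₂.reg rI = k := (hF₂.reg rI rfl).trans hi₁
      have hM₂ : s₂.arr aMulN = s.arr aMulN := (hF₂.arr aMulN rfl).trans (hF₁.arr aMulN rfl)
      have hP₂ : s₂.arr aPref = s.arr aPref := (hF₂.arr aPref rfl).trans (hF₁.arr aPref rfl)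
      refine Run.mono (Run.store (R := fun s'' => ∀ y, s''.arr aRank y =
        countZeros s n y (if y < k then n else if y = k then l + 1 else 0)) fun y => ?_)
        (by simp [RExpr.cost]) fun _ _ h => h
      simp only [Store.setArr_arr, if_true, eval_add, eval_eq, eval_reg, eval_const, eval_load, hi₂,
        hj₂, hM₂, hP₂, hmul k hk]
      by_cases hy : y = k
      · subst hy
        rw [Function.update_self, hI₂ y]
        simp only [lt_irrefl, if_false, if_true, countZeros, Finset.sum_range_succ]
      · rw [Function.update_of_ne hy, hI₂ y]
        simp [hy]
    · change s'.arr aRank y = _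
      rw [h y, hN₁]
      congr 1
      split_ifs <;> omega
  · rw [h y]
    simp [hmn, hy]

/-- The cost of assigning player `i` to position `j`. -/
def costOf (s : Store) (n K i j : ℕ) : ℕ :=
  s.arr aRank (i * n + j % n) + s.arr aPow K -
    if s.arr aVal (i * n + j % n) = 0 then 0 else s.arr aPow (K - (j + 1))

theorem mul_add_inj {K i j i' j' : ℕ} (hj : j < K) (hj' : j' < K) (h : i * K + j = i' * K + j') :
    i = i' ∧ j = j' := by
  have h1 := congrArg (· / K) h
  have h2 := congrArg (· % K) h
  simp only [Nat.mul_add_mod_self_right, Nat.mod_eq_of_lt hj, Nat.mod_eq_of_lt hj'] at h2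
  have hK : 0 < K := by omega
  simp only [Nat.add_comm _ j, Nat.add_comm _ j', Nat.add_mul_div_right _ _ hK,
    Nat.div_eq_of_lt hj, Nat.div_eq_of_lt hj', zero_add] at h1
  exact ⟨h1, h2⟩

theorem run_costs {s : Store} {n m K : ℕ} (hM : s.reg rM = m)
    (hK : s.reg rK = K) (hmulN : ∀ i < m, s.arr aMulN i = i * n)
    (hmulK : ∀ i < m, s.arr aMulK i = i * K) (hteam : ∀ j < K, s.arr aTeam j = j % n) :
    Run costs s (m * (K * 40 + 50) + (K * 40 + 52)) (fun s' => ∀ i < m, ∀ j < K,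
      s'.arr aCost (i * K + j) = costOf s n K i j) := by
  refine Run.mono (Run.forLoop (T := K * 40 + 42) (fun k s' => ∀ i < k, ∀ j < K,
      s'.arr aCost (i * K + j) = costOf s n K i j) rfl rfl (by simp) ?_)
    (by rw [hM]) fun s' _ h => by rwa [hM] at h
  intro k hk s₁ hF₁ hi₁ hI₁
  rw [hM] at hk
  have hK₁ : s₁.reg rK = K := (hF₁.reg rK rfl).trans hK
  refine Run.mono (Run.forLoop (T := 32) (fun l s' => ∀ i j, j < K → i < k ∨ i = k ∧ j < l →
      s'.arr aCost (i * K + j) = costOf s n K i j) rfl rfl ?_ ?_)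
    (by rw [hK₁]) fun s' _ h => ?_
  · intro i j hj hij
    simpa using hI₁ i (by simpa using hij) j hj
  · intro l hl s₂ hF₂ hj₂ hI₂
    rw [hK₁] at hl
    have hi₂ : s₂.reg rI = k := (hF₂.reg rI rfl).trans hi₁
    have hK₂ : s₂.reg rK = K := (hF₂.reg rK rfl).trans hK₁
    have harr : ∀ a ≠ aCost, s₂.arr a = s.arr a := fun a ha => by
      rw [hF₂.arr a (by simpa [forLoop, Prog.writesArr, costEntry] using ha),
        hF₁.arr a (by simpa [forLoop, Prog.writesArr, costEntry] using ha)]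
    have hcell : cellExpr.eval s₂ = k * n + l % n := by
      simp [cellExpr, hi₂, hj₂, harr, hmulN k hk, hteam l hl]
    have hupd : ∀ s'' : Store, s''.arr aCost = Function.update (s₂.arr aCost) (k * K + l)
        (costOf s n K k l) → ∀ i j, j < K → i < k ∨ i = k ∧ j < l + 1 →
        s''.arr aCost (i * K + j) = costOf s n K i j := by
      intro s'' hs i j hj hij
      rw [hs]
      by_cases e : i * K + j = k * K + l
      · obtain ⟨rfl, rfl⟩ := mul_add_inj hj hl e
        simp
      · rw [Function.update_of_ne e]
        refine hI₂ i j hj (hij.imp_right fun h => ⟨h.1, ?_⟩)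
        have : j ≠ l := fun e' => e (by rw [h.1, e'])
        omega
    have hidx : (add (load aMulK (reg rI)) (reg rJ)).eval s₂ = k * K + l := by
      simp [hi₂, hj₂, harr, hmulK k hk]
    refine Run.mono (Run.ite (T := 25) (fun he => Run.mono (Run.store (R := fun s'' =>
      ∀ i j, j < K → i < k ∨ i = k ∧ j < l + 1 → s''.arr aCost (i * K + j) = costOf s n K i j)
        (hupd _ ?_)) (by simp [RExpr.cost, baseExpr, cellExpr]) fun _ _ h => h)
      fun he => Run.mono (Run.store (hupd _ ?_)) (by simp [RExpr.cost, baseExpr, cellExpr])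
        fun _ _ h => h)
      (by simp [RExpr.cost, cellExpr]) fun _ _ h => h
    · have he' : s.arr aVal (k * n + l % n) ≠ 0 := by simpa [hcell, harr] using he
      rw [Store.setArr_arr, if_pos rfl, hidx]
      congr 1
      simp [baseExpr, hcell, harr, hK₂, hj₂, costOf, he']
    · have he' : s.arr aVal (k * n + l % n) = 0 := by simpa [hcell, harr] using he
      rw [Store.setArr_arr, if_pos rfl, hidx]
      congr 1
      simp [baseExpr, hcell, harr, hK₂, costOf, he']
  · intro i hik j hj
    rw [hK₁] at h
    refine h i j hj ?_
    omega

theorem run_output (s : Store) :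
    Run output s (s.reg rM * 14 + 16) (fun s' => ∀ i < s.reg rM,
      s'.arr aOut i = s.arr aTeam (s.arr aMate i)) := by
  refine Run.mono (Run.forLoop (T := 6) (fun k s' => ∀ i < k,
    s'.arr aOut i = s.arr aTeam (s.arr aMate i)) rfl rfl (by simp) ?_) le_rfl fun _ _ h => h
  intro k _ s' hF hi hI
  have hT : s'.arr aTeam = s.arr aTeam := hF.arr aTeam rfl
  have hM : s'.arr aMate = s.arr aMate := hF.arr aMate rfl
  refine Run.mono (Run.store (R := fun s'' => ∀ i < k + 1,
    s''.arr aOut i = s.arr aTeam (s.arr aMate i)) fun i hik => ?_)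
    (by simp [RExpr.cost]) fun _ _ h => h
  simp only [Store.setArr_arr, if_true, eval_reg, eval_load, hi, hT, hM]
  rcases Nat.lt_succ_iff_lt_or_eq.1 hik with h1 | rfl
  · rw [Function.update_of_ne h1.ne]
    exact hI i h1
  · simp

end Preparation

/-! ### The algorithm on an instance -/

namespace Market

variable {n m : ℕ}

theorem input_val (I : Market n (Fin m)) (p : Fin m) (i : Fin n) :
    I.input.arr aVal ((p : ℕ) * n + i) ≠ 0 ↔ I.v i p = 1 := by
  simp only [input, true_and, zero_ne_one, false_and, if_false, ne_eq, ite_eq_right_iff,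
    one_ne_zero, imp_false, not_not]
  constructor
  · rintro ⟨p', i', h, hv⟩
    obtain ⟨h1, h2⟩ := Preparation.mul_add_inj i.2 i'.2 h
    rwa [Fin.ext h1, Fin.ext h2]
  · exact fun h => ⟨p, i, rfl, h⟩

theorem input_pref (I : Market n (Fin m)) (p : Fin m) (i j : Fin n) :
    I.input.arr aPref (((p : ℕ) * n + i) * n + j) = 0 ↔ ¬ I.pref p i j := by
  simp only [input, true_and, one_ne_zero, false_and, if_false, ite_eq_right_iff, imp_false,
    not_iff_not]
  constructor
  · rintro ⟨p', i', j', h, hv⟩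
    obtain ⟨h1, h2⟩ := Preparation.mul_add_inj j.2 j'.2 h
    obtain ⟨h3, h4⟩ := Preparation.mul_add_inj i.2 i'.2 h1
    rwa [Fin.ext h2, Fin.ext h3, Fin.ext h4]
  · exact fun h => ⟨p, i, j, rfl, h⟩

theorem input_arr (I : Market n (Fin m)) {a : ℕ} (ha : 2 ≤ a) (k : ℕ) : I.input.arr a k = 0 := by
  have h0 : a ≠ 0 := by omega
  have h1 : a ≠ 1 := by omega
  simp [input, h0, h1]

theorem sPref_iff (I : Market n (Fin m)) (p : Fin m) (i j : Fin n) :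
    I.SPref p j i ↔ ¬ I.pref p i j :=
  ⟨fun h => h.2, fun h => ⟨(I.pref_total p i j).resolve_left h, h⟩⟩

/-- By totality, a zero in the row of `p` and `i` marks precisely a team that `p` strictly prefers
to `i`. -/
theorem countZeros_input (I : Market n (Fin m)) (p : Fin m) (i : Fin n) :
    Preparation.countZeros I.input n ((p : ℕ) * n + i) n + 1 = I.rank p i := by
  classical
  rw [Preparation.countZeros, Finset.sum_range, rank, add_comm, Finset.card_filter]
  congr 1
  refine Finset.sum_congr rfl fun j _ => ?_
  simp only [I.input_pref, I.sPref_iff]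

end Market

/-! ### The whole program: correctness and running time. -/

namespace Preparation

/-- A bound for the running time of the algorithm in terms of the number `K` of positions. -/
def algorithmTime (K : ℕ) : ℕ :=
  (K + 1) * (Hungarian.insertTime K K + 8) + 200 * (K + 1) ^ 2 + 500

theorem run_algorithm {n m : ℕ} [NeZero n] (I : Market n (Fin m)) (hb : I.IsBinary) :
    Run algorithm I.input (algorithmTime (n * m + n)) (fun s =>
      ∃ A : Alloc n (Fin m), s.Holds A ∧ I.AlgorithmOutput A) := by
  have hn : 0 < n := NeZero.pos n
  set K := n * m + n with hKdef
  have hmK : m ≤ K := (Nat.le_mul_of_pos_left m hn).trans (Nat.le_add_right _ _)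
  have hnK : n ≤ K := Nat.le_add_left _ _
  have hmnK : m * n ≤ K := by
    rw [mul_comm]
    exact Nat.le_add_right _ _
  have e0 : I.input.reg rN = n := rfl
  have e1 : I.input.reg rM = m := rfl
  have hz : ∀ a, 2 ≤ a → ∀ k, I.input.arr a k = 0 := fun a ha k => I.input_arr ha k
  refine Run.mono (T₁ := (m * 12 + 16) + ((K * 16 + 18) + ((K * 16 + 18) + ((K * 30 + 40) +
    ((K * 17 + 30) + ((m * n * (n * 22 + 32) + (n * 22 + 40)) +
    ((m * (K * 40 + 50) + (K * 40 + 52)) + ((m * (Hungarian.insertTime m K + 8) +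
    (Hungarian.insertTime m K + 10)) + (m * 14 + 16)))))))))
    (Run.seq ((run_slots _).mono (by rw [e1]) fun _ _ h => h) fun s₁ hF₁ h₁ => ?_) ?_
    fun _ _ h => h
  · have hK₁ : s₁.reg rK = K := by rw [h₁, e0, e1, hKdef]; ring
    have hN₁ : s₁.reg rN = n := hF₁.reg rN rfl
    have hM₁ : s₁.reg rM = m := hF₁.reg rM rfl
    have hA₁ : s₁.arr = I.input.arr := funext fun a => hF₁.arr a rfl
    refine Run.seq ((run_table (x := rN) (by decide) (by rw [hA₁]; exact hz _ (by decide) _)).mono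
      (by rw [hK₁]) fun _ _ h => h) fun s₂ hF₂ h₂ => ?_
    rw [hK₁, hN₁] at h₂
    have hK₂ : s₂.reg rK = K := (hF₂.reg rK rfl).trans hK₁
    have hN₂ : s₂.reg rN = n := (hF₂.reg rN rfl).trans hN₁
    have hM₂ : s₂.reg rM = m := (hF₂.reg rM rfl).trans hM₁
    have hA₂ : ∀ a ≠ aMulN, s₂.arr a = I.input.arr a := fun a ha =>
      (hF₂.arr a (by simp [table, Prog.forLoop, Prog.writesArr, ha])).trans (by rw [hA₁])
    refine Run.seq ((run_table (x := rK) (by decide) (by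
      rw [hA₂ _ (by decide)]; exact hz _ (by decide) _)).mono (by rw [hK₂]) fun _ _ h => h)
        fun s₃ hF₃ h₃ => ?_
    rw [hK₂] at h₃
    have hK₃ : s₃.reg rK = K := (hF₃.reg rK rfl).trans hK₂
    have hN₃ : s₃.reg rN = n := (hF₃.reg rN rfl).trans hN₂
    have hM₃ : s₃.reg rM = m := (hF₃.reg rM rfl).trans hM₂
    have hmulN₃ : ∀ i ≤ K, s₃.arr aMulN i = i * n := by rwa [hF₃.arr aMulN rfl]
    refine Run.seq ((run_teams (by rw [hN₃]; exact hn)).mono (by rw [hK₃]) fun _ _ h => h)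
      fun s₄ hF₄ h₄ => ?_
    rw [hK₃, hN₃] at h₄
    have hK₄ : s₄.reg rK = K := (hF₄.reg rK rfl).trans hK₃
    have hN₄ : s₄.reg rN = n := (hF₄.reg rN rfl).trans hN₃
    have hM₄ : s₄.reg rM = m := (hF₄.reg rM rfl).trans hM₃
    have hmulN₄ : ∀ i ≤ K, s₄.arr aMulN i = i * n := by rwa [hF₄.arr aMulN rfl]
    refine Run.seq ((run_powers _).mono (by rw [hK₄]) fun _ _ h => h) fun s₅ hF₅ h₅ => ?_
    rw [hK₄, hM₄, hmulN₄ m hmK] at h₅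
    have hK₅ : s₅.reg rK = K := (hF₅.reg rK rfl).trans hK₄
    have hN₅ : s₅.reg rN = n := (hF₅.reg rN rfl).trans hN₄
    have hM₅ : s₅.reg rM = m := (hF₅.reg rM rfl).trans hM₄
    have hmulN₅ : ∀ i ≤ K, s₅.arr aMulN i = i * n := by rwa [hF₅.arr aMulN rfl]
    have hP₅ : s₅.arr aPref = I.input.arr aPref := by
      rw [hF₅.arr aPref rfl, hF₄.arr aPref rfl, hF₃.arr aPref rfl, hA₂ _ (by decide)]
    refine Run.seq (run_ranks hN₅ (by rw [hM₅, hmulN₅ m hmK])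
      (fun y hy => hmulN₅ y (hy.le.trans hmnK)) fun y => by
        rw [hF₅.arr aRank rfl, hF₄.arr aRank rfl, hF₃.arr aRank rfl, hA₂ _ (by decide)]
        exact hz _ (by decide) _) fun s₆ hF₆ h₆ => ?_
    have hK₆ : s₆.reg rK = K := (hF₆.reg rK rfl).trans hK₅
    have hM₆ : s₆.reg rM = m := (hF₆.reg rM rfl).trans hM₅
    have hteam₆ : ∀ j < K, s₆.arr aTeam j = j % n := by rwa [hF₆.arr aTeam rfl, hF₅.arr aTeam rfl]
    have hmulK₆ : ∀ i ≤ K, s₆.arr aMulK i = i * K := by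
      rwa [hF₆.arr aMulK rfl, hF₅.arr aMulK rfl, hF₄.arr aMulK rfl]
    refine Run.seq (run_costs (n := n) hM₆ hK₆ (fun i hi => by
        rw [hF₆.arr aMulN rfl, hmulN₅ i (by omega)]) (fun i hi => hmulK₆ i (by omega)) hteam₆)
      fun s₇ hF₇ h₇ => ?_
    have hK₇ : s₇.reg rK = K := (hF₇.reg rK rfl).trans hK₆
    have hM₇ : s₇.reg rM = m := (hF₇.reg rM rfl).trans hM₆
    -- The preparation does not touch the arrays of the Hungarian method, so they start at zero.
    have hz₇ : ∀ a, 9 ≤ a → ∀ k, s₇.arr a k = 0 := fun a ha k => by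
      have ha' : ∀ b < 9, a ≠ b := fun b hb => by omega
      rw [hF₇.arr a, hF₆.arr a, hF₅.arr a, hF₄.arr a, hF₃.arr a, hA₂ a (ha' _ (by decide)),
        hz a (by omega)] <;>
      simp [costs, costEntry, ranks, powers, teams, table, Prog.forLoop, Prog.writesArr, ha']
    refine Run.seq (Hungarian.run_solve
      (C := fun i j => s₇.arr aCost (s₇.arr aMulK i + j)) (fun _ _ => rfl) hM₇ hK₇ hmK
        (hz₇ _ (by decide)) (hz₇ _ (by decide)) (hz₇ _ (by decide))) fun s₈ hF₈ h₈ => ?_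
    have hM₈ : s₈.reg rM = m := (hF₈.reg rM rfl).trans hM₇
    refine (run_output _).mono (by rw [hM₈]) fun s₉ hF₉ h₉ => ?_
    rw [hM₈] at h₉
    refine ⟨fun p => Fin.ofNat n (s₈.arr aMate p), fun p => ?_, ?_⟩
    · rw [h₉ p p.2, hF₈.arr aTeam rfl, hF₇.arr aTeam rfl, hteam₆ _ (h₈.mate_lt p p.2)]
      rfl
    · have hcost : ∀ (p : Fin m) (q : ℕ), q < K →
          s₇.arr aCost (s₇.arr aMulK p + q) = costOf s₆ n K p q := fun p q hq => by
        rw [hF₇.arr aMulK rfl, hmulK₆ p (p.2.le.trans hmK), h₇ p p.2 q hq]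
      have hcell : ∀ (p : Fin m) (q : ℕ), (p : ℕ) * n + q % n < m * n := fun p q => by
        have h1 : ((p : ℕ) + 1) * n ≤ m * n := Nat.mul_le_mul_right n p.2
        have h2 := Nat.mod_lt q hn
        rw [add_mul, one_mul] at h1
        omega
      have hrank : ∀ (p : Fin m) (q : ℕ), s₆.arr aRank ((p : ℕ) * n + q % n) + 1 =
          I.rank p (Fin.ofNat n q) := fun p q => by
        rw [h₆ _ (hcell p q), ← I.countZeros_input]
        simp only [countZeros, hP₅]
        rfl
      have hval : ∀ (p : Fin m) (q : ℕ), s₆.arr aVal ((p : ℕ) * n + q % n) ≠ 0 ↔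
          I.v (Fin.ofNat n q) p = 1 := fun p q => by
        rw [hF₆.arr aVal rfl, hF₅.arr aVal rfl, hF₄.arr aVal rfl, hF₃.arr aVal rfl,
          hA₂ _ (by decide), ← I.input_val]
        rfl
      have hpow : ∀ k ≤ K, s₆.arr aPow k = (m * n + 1) * 2 ^ k := by rwa [hF₆.arr aPow rfl]
      -- `M` is the least number above `n * m`, and the offset `B` keeps all costs natural.
      refine Market.algorithmOutput_of_cost hb (M := m * n + 1) (B := (m * n + 1) * 2 ^ K)
        (by rw [Fintype.card_fin, mul_comm]; omega)
        (fun p q => s₇.arr aCost (s₇.arr aMulK p + q)) ?_ ?_ (f := fun p => s₈.arr aMate p)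
        ?_ ?_ ?_
      all_goals try simp only [Fintype.card_fin, ← hKdef]
      · intro p q hq hv
        have : s₆.arr aVal ((p : ℕ) * n + q % n) = 0 := by
          by_contra hne
          rw [(hval p q).1 hne] at hv
          exact one_ne_zero hv
        rw [hcost p q hq, costOf, if_pos this, hpow K le_rfl, ← hrank p q]
        omega
      · intro p q hq hv
        -- The offset dominates the bonus, so the truncated subtraction in `costOf` is exact.
        have hle : (m * n + 1) * 2 ^ (K - (q + 1)) ≤ (m * n + 1) * 2 ^ K :=
          Nat.mul_le_mul_left _ (Nat.pow_le_pow_right (by decide) (Nat.sub_le _ _))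
        rw [hcost p q hq, costOf, if_neg ((hval p q).2 hv), hpow K le_rfl,
          hpow _ (Nat.sub_le _ _), ← hrank p q, Nat.sub_sub, add_comm 1 q]
        omega
      · exact fun p => h₈.mate_lt p p.2
      · exact fun p p' hp => Fin.ext (h₈.inj p p.2 p' p'.2 hp)
      · exact fun g hg hg' => h₈.sum_le hg hg'
  · have t1 : Hungarian.insertTime m K ≤ Hungarian.insertTime K K := by
      unfold Hungarian.insertTime
      gcongr
    have t2 : m * (Hungarian.insertTime m K + 8) ≤ K * (Hungarian.insertTime K K + 8) := by
      gcongr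
    have t3 : m * n * (n * 22 + 32) ≤ K * (K * 22 + 32) := by gcongr
    have t4 : m * (K * 40 + 50) ≤ K * (K * 40 + 50) := by gcongr
    unfold algorithmTime
    nlinarith

end Preparation

end TwoSided

theorem theorem6 :
    (∀ (n m : ℕ) [NeZero n] (I : TwoSided.Market n (Fin m)), I.IsBinary →
      ∀ A : TwoSided.Alloc n (Fin m), I.AlgorithmOutput A → I.EF1 A ∧ I.PO A) ∧
    ∃ (c : TwoSided.Prog) (bound : Polynomial ℕ),
      ∀ (n m : ℕ) [NeZero n] (I : TwoSided.Market n (Fin m)), I.IsBinary →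
        ∃ (t : ℕ) (s : TwoSided.Store) (A : TwoSided.Alloc n (Fin m)),
          TwoSided.Exec c I.input t s ∧ t ≤ bound.eval (n + m) ∧
            s.Holds A ∧ I.AlgorithmOutput A := by
  refine ⟨fun n m _ I hb A hA => hA.eF1_and_pO hb, TwoSided.Preparation.algorithm, ?_⟩
  -- `P` evaluated at `n + m` bounds the number `n * m + n` of positions; the bound below is
  -- `algorithmTime` with `P` in its place.
  let P : Polynomial ℕ := Polynomial.X * Polynomial.X + Polynomial.X
  refine ⟨(P + 1) * ((P + 1) * ((P + 1) * (P * 58 + 108) + (P * 88 + 170) + 3) + (P + 1) * 40 + 50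
    + 8) + 200 * (P + 1) ^ 2 + 500, fun n m _ I hb => ?_⟩
  obtain ⟨t, s, h1, h2, A, h3, h4⟩ := TwoSided.Preparation.run_algorithm I hb
  refine ⟨t, s, A, h1, h2.trans ?_, h3, h4⟩
  have hK : n * m + n ≤ (n + m) * (n + m) + (n + m) := by nlinarith
  simp only [TwoSided.Preparation.algorithmTime, TwoSided.Hungarian.insertTime, P,
    Polynomial.eval_add, Polynomial.eval_mul, Polynomial.eval_pow, Polynomial.eval_X,
    Polynomial.eval_one, Polynomial.eval_ofNat]
  gcongr
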